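/- All posets are finite. A subset of a poset is identified with the induced sub-poset. The height $h_P$ of a poset $P$ is the maximal cardinality minus one of a chain in $P$. Its level sets are $P(0)=\min P$ and $P(k+1)=\min\bigl(P\setminus\bigcup_{i\le k}P(i)\bigr)$ for $0\le k<h_P$; put $P(k,\ell)=P(k)\cup P(\ell)$ and $P(k\to\ell)=\bigcup_{i=k}^{\ell}P(i)$. A retract of $P$ is the image of an idempotent order-preserving map $P\to P$. For $n\ge2$, a $2n$-crown is a poset with $2n$ points $x_{i,0},x_{i,1}$ ($0\le i<n$) whose only comparabilities between different points are $x_{0,0}<x_{0,1}>x_{1,0}<\cdots>x_{n-1,0}<x_{n-1,1}>x_{0,0}$. A $2n$-crown stack is a poset $P$ of height $\ge1$ in which every $P(k,k+1)$, $0\le k<h_P$, is a $2n$-crown and all other comparabilities are induced by transitivity. Let $33$ denote the ordinal sum of two 3-element antichains, and $3C$ the disjoint union of three 2-element chains. A section is a 2-element antichain, or a poset $P$ of height $h_P\ge1$ with points $c_{k,j}$ ($0\le k\le h_P$, $j\in\{0,1,2\}$, pairwise distinct) such that $c_{0,j}<\cdots<c_{h_P,j}$ for every $j$, $\{c_{k,0},c_{k,1},c_{k,2}\}$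 is an antichain for every $k$, the map $c_{k,j}\mapsto c_{k,(j+1)\bmod 3}$ is an automorphism, and $P(k,k+1)\not\simeq33$ for $0\le k<h_P$. It is nice if no point has exactly one lower cover or exactly one upper cover. The class $\mathfrak N_2$ consists of the nice sections $P$ of height $\ge2$ with horizon two, i.e. for which $\eta=2$ is the least integer $\eta$ with $P(k,k+\eta)\simeq33$ for all $0\le k\le h_P-\eta$. The class $\mathfrak N_2^{LS}$ consists (up to isomorphism) of the lower segments $P(0\to k)$, $0\le k\le h_P$, of the posets $P\in\mathfrak N_2$. A poset $Q$ of height $n\geq 1$ has the code $c_0c_1\dots c_{n-1}\in\{0,1\}^n$ if, for every $0\le k<n$, $Q(k,k+1)$ is a 6-crown when $c_k=1$ and is of type $3C$ when $c_k=0$. Consider the following table of codes, each marked y or n. - height 1, mark y: none. - height 1, mark n: $1$. - height 2, mark y: $10$. - height 2, mark n: $11$. - height 3, mark y: $111$, $101$. - height 3, mark n: $110$, $100$. - height 4, mark y: $1001$, $1010$, $1000$. - height 4, mark n: $1111$, $1101$, $1011$, $1110$, $1100$. - height 5, mark y: $11101$, $10111$, $11001$, $10101$, $10011$, $10001$, $11110$,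 $11100$, $10110$, $10100$. - height 5, mark n: $11111$, $11011$, $11010$, $11000$, $10010$, $10000$. - height 6, mark y: $111111$, $111101$, $101111$, $101101$, $101001$, $100101$, $100001$, $101010$, $100110$, $101000$, $100100$, $100010$, $100000$. - height 6, mark n: $111011$, $110111$, $111001$, $110101$, $110011$, $101011$, $100111$, $110001$, $100011$, $111110$, $111100$, $111010$, $110110$, $101110$, $111000$, $110100$, $101100$, $110010$, $110000$. Then the following holds. 1. Every $Q\in\mathfrak N_2^{LS}$ of height between one and six has exactly one code, and this code is listed in the table. 2. Every code in the table is the code of some $Q\in\mathfrak N_2^{LS}$, and any two elements of $\mathfrak N_2^{LS}$ with this code are isomorphic. 3. If $Q\in\mathfrak N_2^{LS}$ has a code listed in the table, then $Q$ has a 4-crown stack as retract if and only if its code is marked y. 4. In particular, a poset $P\in\mathfrak N_2$ of height at most six has a 4-crown stack as retract if and only if its code is marked y in the table. -/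

import Mathlib

universe u

namespace NiceSection

/-- `lowPart P k` is the union of the first `k` level sets `P(0), …, P(k-1)`. -/
def lowPart (P : Type u) [PartialOrder P] : ℕ → Set P
  | 0 => ∅
  | k + 1 => lowPart P k ∪ {x | Minimal (fun y => y ∉ lowPart P k) x}

/-- The level set `P(k)`: the minimal points of what remains of `P` after the removal of
`P(0), …, P(k-1)`. -/
def level (P : Type u) [PartialOrder P] (k : ℕ) : Set P :=
  {x | Minimal (fun y => y ∉ lowPart P k) x}

/-- The level pair `P(k, l) = P(k) ∪ P(l)` (used as an induced sub-poset). -/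
def levelPair (P : Type u) [PartialOrder P] (k l : ℕ) : Set P :=
  level P k ∪ level P l

/-- The segment `P(k → l) = P(k) ∪ … ∪ P(l)` (used as an induced sub-poset). -/
def segment (P : Type u) [PartialOrder P] (k l : ℕ) : Set P :=
  {x | ∃ i, k ≤ i ∧ i ≤ l ∧ x ∈ level P i}

/-- The maximal length (cardinality minus one) of a chain in `P` is `h`. -/
def HasHeight (P : Type u) [PartialOrder P] (h : ℕ) : Prop :=
  Order.krullDim P = h

/-- `P` consists of the `2 n` points `x i 0` (lower row) and `x i 1` (upper row), `i < n`, and the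
only strict comparabilities are `x i 0 < x j 1` with `E i j`. -/
def IsTwoRowed (n : ℕ) (E : Fin n → Fin n → Prop) (P : Type u) [PartialOrder P] : Prop :=
  ∃ x : Fin n × Fin 2 ≃ P, ∀ a b : Fin n × Fin 2,
    x a < x b ↔ a.2 = 0 ∧ b.2 = 1 ∧ E a.1 b.1

/-- The `2n`-crown `x₀₀ < x₀₁ > x₁₀ < x₁₁ > ⋯ > xₙ₋₁,₀ < xₙ₋₁,₁ > x₀₀`, `n ≥ 2`. -/
def IsCrown (n : ℕ) (P : Type u) [PartialOrder P] : Prop :=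
  2 ≤ n ∧ IsTwoRowed n (fun i j => i = j ∨ (i : ℕ) = ((j : ℕ) + 1) % n) P

/-- Type `33`: the ordinal sum of two antichains of size three. -/
def IsThreeThree (P : Type u) [PartialOrder P] : Prop :=
  IsTwoRowed 3 (fun _ _ => True) P

/-- Type `3C`: three disjoint chains of height one without additional comparabilities. -/
def IsThreeC (P : Type u) [PartialOrder P] : Prop :=
  IsTwoRowed 3 (fun i j => i = j) P

/-- A `2n`-crown stack: a poset of height at least one in which consecutive levels form
`2n`-crowns and all other comparabilities are induced by transitivity. -/
def IsCrownStack (n : ℕ) (P : Type u) [PartialOrder P] : Prop :=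
  ∃ h : ℕ, 1 ≤ h ∧ HasHeight P h ∧
    (∀ k < h, IsCrown n (levelPair P k (k + 1))) ∧
    ∀ x y : P, x < y →
      Relation.TransGen (fun a b => a < b ∧ ∃ k, a ∈ level P k ∧ b ∈ level P (k + 1)) x y

/-- `R` is a retract of `P`: the image of an idempotent order homomorphism `P → P`. -/
def IsRetract {P : Type u} [PartialOrder P] (R : Set P) : Prop :=
  ∃ r : P →o P, (∀ x, r (r x) = r x) ∧ Set.range r = R

/-- `P` has a 4-crown stack as retract. -/
def HasFourCrownStackRetract (P : Type u) [PartialOrder P] : Prop :=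
  ∃ R : Set P, IsRetract R ∧ IsCrownStack 2 R

/-- A point with a single lower cover or a single upper cover. -/
def IsIrreduciblePoint {P : Type u} [PartialOrder P] (x : P) : Prop :=
  (∃! y, y ⋖ x) ∨ (∃! y, x ⋖ y)

/-- A section: a two-element antichain, or a poset of height `h ≥ 1` whose points are
`c (k, j)`, `k ≤ h`, `j ∈ ℤ/3`, such that the `c (·, j)` are chains, the `c (k, ·)` are antichains,
the shift `j ↦ j + 1` is an automorphism, and no consecutive level pair is of type `33`. -/
def IsSection (P : Type u) [PartialOrder P] : Prop :=
  (Nat.card P = 2 ∧ ∀ x y : P, x ≤ y → x = y) ∨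
  ∃ h : ℕ, 1 ≤ h ∧ HasHeight P h ∧
    (∃ c : Fin (h + 1) × Fin 3 ≃ P,
      (∀ j, StrictMono fun k => c (k, j)) ∧
      (∀ k i j, c (k, i) ≤ c (k, j) → i = j) ∧
      (∀ k i l j, c (k, i) ≤ c (l, j) ↔ c (k, i + 1) ≤ c (l, j + 1))) ∧
    ∀ k < h, ¬ IsThreeThree (levelPair P k (k + 1))

/-- A nice section: a section without irreducible points. -/
def IsNiceSection (P : Type u) [PartialOrder P] : Prop :=
  IsSection P ∧ ∀ x : P, ¬ IsIrreduciblePoint x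

/-- The horizon of a poset of height `h` is `η`: the least integer such that all level pairs
`P(k, k + η)`, `0 ≤ k ≤ h - η`, are of type `33`. -/
def HasHorizon (P : Type u) [PartialOrder P] (h η : ℕ) : Prop :=
  IsLeast {e : ℕ | ∀ k, k + e ≤ h → IsThreeThree (levelPair P k (k + e))} η

/-- The class `𝔑₂`: nice sections of height at least two with horizon two. -/
def IsN2 (P : Type u) [PartialOrder P] : Prop :=
  IsNiceSection P ∧ ∃ h : ℕ, 2 ≤ h ∧ HasHeight P h ∧ HasHorizon P h 2

/-- The class `𝔑₂^LS` (up to isomorphism): lower segments `P(0 → k)`, `k ≤ h_P`, of members `P`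
of `𝔑₂`. -/
def IsN2LS (Q : Type u) [PartialOrder Q] : Prop :=
  ∃ (P : Type u) (_ : PartialOrder P), IsN2 P ∧
    ∃ h k : ℕ, HasHeight P h ∧ k ≤ h ∧ Nonempty (Q ≃o segment P 0 k)

/-- `w` is the sequence of the types of the consecutive level pairs `Q(k, k + 1)`, where `1` stands
for a 6-crown and `0` for the type `3C`. -/
def HasCode (Q : Type u) [PartialOrder Q] (w : List (Fin 2)) : Prop :=
  HasHeight Q w.length ∧
    ∀ (k : ℕ) (hk : k < w.length),
      (w[k] = 1 → IsCrown 3 (levelPair Q k (k + 1))) ∧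
      (w[k] = 0 → IsThreeC (levelPair Q k (k + 1)))

/-- The table of the codes of height one to six; `true` is the mark `y`, `false` the mark `n`. -/
def table : List (List (Fin 2) × Bool) :=
  [
   ([1], false),
   ([1,1], false), ([1,0], true),
   ([1,1,1], true), ([1,0,1], true), ([1,1,0], false),
   ([1,0,0], false),
   ([1,1,1,1], false), ([1,1,0,1], false), ([1,0,1,1], false),
   ([1,0,0,1], true), ([1,1,1,0], false), ([1,1,0,0], false),
   ([1,0,1,0], true), ([1,0,0,0], true),
   ([1,1,1,1,1], false), ([1,1,1,0,1], true), ([1,1,0,1,1], false),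
   ([1,0,1,1,1], true), ([1,1,0,0,1], true), ([1,0,1,0,1], true),
   ([1,0,0,1,1], true), ([1,0,0,0,1], true), ([1,1,1,1,0], true),
   ([1,1,1,0,0], true), ([1,1,0,1,0], false), ([1,0,1,1,0], true),
   ([1,1,0,0,0], false), ([1,0,1,0,0], true), ([1,0,0,1,0], false),
   ([1,0,0,0,0], false),
   ([1,1,1,1,1,1], true), ([1,1,1,1,0,1], true), ([1,1,1,0,1,1], false),
   ([1,1,0,1,1,1], false), ([1,0,1,1,1,1], true), ([1,1,1,0,0,1], false),
   ([1,1,0,1,0,1], false), ([1,0,1,1,0,1], true), ([1,1,0,0,1,1], false),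
   ([1,0,1,0,1,1], false), ([1,0,0,1,1,1], false), ([1,1,0,0,0,1], false),
   ([1,0,1,0,0,1], true), ([1,0,0,1,0,1], true), ([1,0,0,0,1,1], false),
   ([1,0,0,0,0,1], true), ([1,1,1,1,1,0], false), ([1,1,1,1,0,0], false),
   ([1,1,1,0,1,0], false), ([1,1,0,1,1,0], false), ([1,0,1,1,1,0], false),
   ([1,1,1,0,0,0], false), ([1,1,0,1,0,0], false), ([1,0,1,1,0,0], false),
   ([1,1,0,0,1,0], false), ([1,0,1,0,1,0], true), ([1,0,0,1,1,0], true),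
   ([1,1,0,0,0,0], false), ([1,0,1,0,0,0], true), ([1,0,0,1,0,0], true),
   ([1,0,0,0,1,0], true), ([1,0,0,0,0,0], true)
  ]

end NiceSection

/-! Everything reduces to words in two letters, crown and `3C`. In a member of `𝔑₂`, horizon two
makes points at least two levels apart comparable, so only consecutive levels carry information. By
the rotation of order three, the comparabilities between two consecutive levels are given by a set
of shifts in ℤ/3. It contains 0 because of the chains, and it is not all of ℤ/3 because type `33` is
excluded. One shift gives `3C`; two shifts give the complement of a perfect matching, a 6-crown.
Relabelling the levels by accumulated shifts yields the normal form `LayerLT`, which depends on the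
word only. If no point has a unique lower cover, the first letter is a crown; conversely, a word
starting with a crown becomes the word of a member of `𝔑₂` once crowns are added on top. So in
positive height `𝔑₂^LS` corresponds to the words starting with a crown (`IsN2LS.exists_isLayering`,
`exists_isN2LS`).

A 4-crown stack is an ordinal sum of two-element antichains. A retraction onto one amounts to an
index and a two-valued colour for every point, such that passing to a larger point raises the index
or keeps both, together with section points (`IsFold`). For the codes marked y such data are listed
and checked.

For the codes marked n an exhaustive search is evaluated. It rests on two reductions. Points can be
moved to lower antichains until the fold is tight (`IsIndexFold.exists_isTightFold`), so each
preimage of an antichain is maximal given the earlier ones; and the two colours of an antichain can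
be swapped, so its first point has a fixed colour. The search builds the preimages from below and
keeps only their union and a set containing the next antichain. A fold makes the search succeed
(`IsTightFold.search_eq_true`), so failure excludes a retract. -/

namespace NiceSection

/-! ### Level sets and height from a rank function -/

/-- A rank function on `P`: strictly monotone and without gaps below. -/
structure IsRank {P : Type u} [PartialOrder P] (ρ : P → ℕ) : Prop where
  lt_of_lt : ∀ {x y}, x < y → ρ x < ρ y
  exists_lt : ∀ x k, ρ x = k + 1 → ∃ y, y < x ∧ ρ y = k

namespace IsRank

variable {P : Type u} [PartialOrder P] {ρ : P → ℕ}

theorem minimal_iff (h : IsRank ρ) (k : ℕ) (x : P) :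
    Minimal (fun y => ¬ ρ y < k) x ↔ ρ x = k := by
  constructor
  · rintro ⟨h1, h2⟩
    by_contra hne
    obtain ⟨m, hm⟩ : ∃ m, ρ x = m + 1 := ⟨ρ x - 1, by omega⟩
    obtain ⟨y, hy, hym⟩ := h.exists_lt x m hm
    exact absurd (h2 (y := y) (by simp only; omega) hy.le) hy.not_ge
  · intro hx
    refine ⟨by simp only; omega, fun y hy hyx => ?_⟩
    rcases hyx.eq_or_lt with rfl | hlt
    · exact le_rfl
    · have := h.lt_of_lt hlt
      simp only at hy
      omega

/-- Since a rank has no gaps, the minimal points outside `{ρ < k}` are those of rank `k`. This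
replaces the recursive levels by fibres, for layered posets, sections and images of folds alike. -/
theorem mem_lowPart (h : IsRank ρ) (k : ℕ) (x : P) : x ∈ lowPart P k ↔ ρ x < k := by
  induction k generalizing x with
  | zero => simp [lowPart]
  | succ k ih =>
    have : x ∈ lowPart P (k + 1) ↔
        x ∈ lowPart P k ∨ Minimal (fun y => y ∉ lowPart P k) x := Iff.rfl
    rw [this]
    simp only [ih, h.minimal_iff]
    omega

theorem mem_level (h : IsRank ρ) (k : ℕ) (x : P) : x ∈ level P k ↔ ρ x = k := by
  have : x ∈ level P k ↔ Minimal (fun y => y ∉ lowPart P k) x := Iff.rfl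
  rw [this]
  simp only [h.mem_lowPart, h.minimal_iff]

theorem mem_levelPair (h : IsRank ρ) (k l : ℕ) (x : P) :
    x ∈ levelPair P k l ↔ ρ x = k ∨ ρ x = l := by
  simp [levelPair, h.mem_level]

theorem mem_segment (h : IsRank ρ) (k : ℕ) (x : P) : x ∈ segment P 0 k ↔ ρ x ≤ k := by
  simp [segment, h.mem_level]

theorem exists_series (h : IsRank ρ) (k : ℕ) (x : P) (hx : ρ x = k) :
    ∃ s : LTSeries P, s.length = k ∧ s.last = x := by
  induction k generalizing x with
  | zero => exact ⟨RelSeries.singleton _ x, rfl, rfl⟩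
  | succ k ih =>
    obtain ⟨y, hy, hk⟩ := h.exists_lt x k hx
    obtain ⟨s, hs, hl⟩ := ih y hk
    exact ⟨s.snoc x (by rw [hl]; exact hy), by simp [hs], by simp⟩

theorem hasHeight (h : IsRank ρ) {n : ℕ} (hle : ∀ x, ρ x ≤ n) (hx : ∃ x, ρ x = n) :
    HasHeight P n := by
  obtain ⟨x, hx⟩ := hx
  apply le_antisymm
  · have : StrictMono (fun x => (⟨ρ x, Nat.lt_succ_of_le (hle x)⟩ : Fin (n + 1))) :=
      fun a b hab => h.lt_of_lt hab
    refine (Order.krullDim_le_of_strictMono _ this).trans ?_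
    exact iSup_le fun p => by
      have := p.length_lt_card
      rw [Fintype.card_fin] at this
      exact_mod_cast Nat.lt_succ_iff.1 this
  · obtain ⟨s, hs, -⟩ := h.exists_series n x hx
    rw [← hs]
    exact Order.LTSeries.length_le_krullDim _

end IsRank

theorem HasHeight.unique {P : Type u} [PartialOrder P] {m n : ℕ} (hm : HasHeight P m)
    (hn : HasHeight P n) : m = n := by
  have : (m : WithBot ℕ∞) = n := hm.symm.trans hn
  exact_mod_cast this

/-- A point surviving the removal of `k` levels was not minimal at any of these stages, so one can
descend `k` times. -/
theorem exists_series_of_notMem_lowPart {P : Type u} [PartialOrder P] (k : ℕ) (x : P)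
    (hx : x ∉ lowPart P k) : ∃ s : LTSeries P, s.length = k ∧ s.last = x := by
  induction k generalizing x with
  | zero => exact ⟨RelSeries.singleton _ x, rfl, rfl⟩
  | succ k ih =>
    have h1 : x ∉ lowPart P k := fun h => hx (Or.inl h)
    have h2 : ¬ Minimal (fun y => y ∉ lowPart P k) x := fun h => hx (Or.inr h)
    obtain ⟨y, hy, hyx⟩ : ∃ y, y ∉ lowPart P k ∧ y < x := by
      by_contra hcon
      push Not at hcon
      refine h2 ⟨h1, fun y hy hyx => ?_⟩
      rcases hyx.eq_or_lt with rfl | hlt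
      · exact le_rfl
      · exact absurd hlt (hcon y hy)
    obtain ⟨s, hs, hl⟩ := ih y hy
    exact ⟨s.snoc x (by rw [hl]; exact hyx), by simp [hs], by simp⟩

theorem mem_lowPart_iff {P : Type u} [PartialOrder P] (k : ℕ) (x : P) :
    x ∈ lowPart P k ↔ ∃ i < k, x ∈ level P i := by
  induction k with
  | zero => simp [lowPart]
  | succ k ih =>
    have : x ∈ lowPart P (k + 1) ↔ x ∈ lowPart P k ∨ x ∈ level P k := Iff.rfl
    rw [this, ih]
    constructor
    · rintro (⟨i, hi, h⟩ | h)
      · exact ⟨i, by omega, h⟩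
      · exact ⟨k, by omega, h⟩
    · rintro ⟨i, hi, h⟩
      rcases Nat.lt_succ_iff_lt_or_eq.1 hi with h' | rfl
      · exact Or.inl ⟨i, h', h⟩
      · exact Or.inr h

theorem HasHeight.exists_mem_level {P : Type u} [PartialOrder P] {n : ℕ} (h : HasHeight P n)
    (x : P) : ∃ k ≤ n, x ∈ level P k := by
  by_contra hcon
  have hx : x ∉ lowPart P (n + 1) := by
    rw [mem_lowPart_iff]
    rintro ⟨i, hi, hl⟩
    exact hcon ⟨i, by omega, hl⟩
  obtain ⟨s, hs, -⟩ := exists_series_of_notMem_lowPart _ x hx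
  have := Order.LTSeries.length_le_krullDim s
  rw [hs, show Order.krullDim P = n from h] at this
  have h2 : n + 1 ≤ n := by exact_mod_cast this
  omega

theorem level_lt_of_lt {P : Type u} [PartialOrder P] {x y : P} {k l : ℕ} (hx : x ∈ level P k)
    (hy : y ∈ level P l) (hxy : x < y) : k < l := by
  by_contra hkl
  have hx' : x ∉ lowPart P l := by
    intro h
    rw [mem_lowPart_iff] at h
    obtain ⟨i, hi, h⟩ := h
    exact hx.1 ((mem_lowPart_iff _ _).2 ⟨i, by omega, h⟩)
  exact absurd (hy.2 hx' hxy.le) hxy.not_ge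

/-- A point lies in at most one level. -/
theorem level_unique {P : Type u} [PartialOrder P] {x : P} {k l : ℕ} (hx : x ∈ level P k)
    (hy : x ∈ level P l) : k = l := by
  rcases lt_trichotomy k l with h | h | h
  · exact absurd ((mem_lowPart_iff _ _).2 ⟨k, h, hx⟩) hy.1
  · exact h
  · exact absurd ((mem_lowPart_iff _ _).2 ⟨l, h, hy⟩) hx.1

/-! ### Recognising the types of level pairs -/

/-- Parametrised criterion for a two-rowed induced sub-poset. -/
theorem isTwoRowed_of_injective {P : Type u} [PartialOrder P] {n : ℕ}
    {E : Fin n → Fin n → Prop} {S : Set P} (f : Fin n × Fin 2 → P) (hf : Function.Injective f)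
    (hS : ∀ x, x ∈ S ↔ ∃ a, f a = x)
    (hlt : ∀ a b, f a < f b ↔ a.2 = 0 ∧ b.2 = 1 ∧ E a.1 b.1) : IsTwoRowed n E S := by
  refine ⟨Equiv.ofBijective (fun a => ⟨f a, (hS _).2 ⟨a, rfl⟩⟩) ⟨?_, ?_⟩, ?_⟩
  · intro a b hab
    exact hf (congrArg Subtype.val hab)
  · rintro ⟨x, hx⟩
    obtain ⟨a, ha⟩ := (hS x).1 hx
    exact ⟨a, Subtype.ext ha⟩
  · intro a b
    exact hlt a b

theorem IsThreeThree.lt_of_lt_of_lt {P : Type u} [PartialOrder P] (h : IsThreeThree P)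
    {x y z t : P} (hxy : x < y) (hzt : z < t) : x < t := by
  obtain ⟨e, he⟩ := h
  obtain ⟨a, rfl⟩ := e.surjective x
  obtain ⟨b, rfl⟩ := e.surjective y
  obtain ⟨c, rfl⟩ := e.surjective z
  obtain ⟨d, rfl⟩ := e.surjective t
  rw [he] at *
  exact ⟨hxy.1, hzt.2.1, trivial⟩

/-- Together with `IsCrown.exists_lt_ne` this tells the two letters apart: a lower point has one
upper bound in type `3C` and more than one in a 6-crown. -/
theorem IsThreeC.eq_of_lt_of_lt {P : Type u} [PartialOrder P] (h : IsThreeC P)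
    {x y z : P} (hxy : x < y) (hxz : x < z) : y = z := by
  obtain ⟨e, he⟩ := h
  obtain ⟨a, rfl⟩ := e.surjective x
  obtain ⟨b, rfl⟩ := e.surjective y
  obtain ⟨c, rfl⟩ := e.surjective z
  rw [he] at *
  exact congrArg e (Prod.ext (hxy.2.2.symm.trans hxz.2.2) (hxy.2.1.trans hxz.2.1.symm))

theorem IsCrown.exists_lt_ne {P : Type u} [PartialOrder P] (h : IsCrown 3 P)
    {x y : P} (hxy : x < y) : ∃ z, x < z ∧ y ≠ z := by
  obtain ⟨-, e, he⟩ := h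
  obtain ⟨a, rfl⟩ := e.surjective x
  obtain ⟨b, rfl⟩ := e.surjective y
  simp only [he, ne_eq,
    EmbeddingLike.apply_eq_iff_eq, e.surjective.exists] at *
  obtain ⟨a1, a2⟩ := a
  obtain ⟨b1, b2⟩ := b
  simp only at hxy
  obtain ⟨rfl, rfl, hE⟩ := hxy
  revert a1 b1
  decide

/-! ### Layered posets and their words -/

/-- The order relation of the layered poset with word `w` in terms of positions `(k, i)`:
points two or more levels apart are comparable, consecutive levels form a 6-crown if `w k` and are
of type `3C` otherwise. -/
def LayerLT (w : ℕ → Bool) (a b : ℕ × Fin 3) : Prop :=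
  a.1 + 2 ≤ b.1 ∨ (a.1 + 1 = b.1 ∧ if w a.1 then a.2 ≠ b.2 else a.2 = b.2)

/-- `pos` identifies `P` with the layered poset of height `n` with word `w`. -/
structure IsLayering {P : Type u} [PartialOrder P] (n : ℕ) (w : ℕ → Bool)
    (pos : P → ℕ × Fin 3) : Prop where
  injective : Function.Injective pos
  fst_le : ∀ x, (pos x).1 ≤ n
  exists_eq : ∀ a : ℕ × Fin 3, a.1 ≤ n → ∃ x, pos x = a
  lt_iff : ∀ x y, x < y ↔ LayerLT w (pos x) (pos y)

/-- The word of length `n` given by `w`, in the alphabet of codes. -/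
def codeOf (n : ℕ) (w : ℕ → Bool) : List (Fin 2) :=
  (List.range n).map fun k => if w k then 1 else 0

theorem length_codeOf (n : ℕ) (w : ℕ → Bool) : (codeOf n w).length = n := by
  simp [codeOf]

theorem LayerLT.fst_lt {w : ℕ → Bool} {a b : ℕ × Fin 3} (h : LayerLT w a b) : a.1 < b.1 := by
  rcases h with h | h <;> omega

/-- Two strict steps rise by at least two levels, where comparability is unconditional, so every
word gives an order. -/
theorem LayerLT.trans {w : ℕ → Bool} {a b c : ℕ × Fin 3} (h : LayerLT w a b)
    (h' : LayerLT w b c) : LayerLT w a c := by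
  have := h.fst_lt
  have := h'.fst_lt
  exact Or.inl (by omega)

theorem exists_isLayering (n : ℕ) (w : ℕ → Bool) :
    ∃ (P : Type u) (_ : PartialOrder P) (pos : P → ℕ × Fin 3), IsLayering n w pos := by
  let P := ULift.{u} {a : ℕ × Fin 3 // a.1 ≤ n}
  let lt (x y : P) : Prop := LayerLT w x.down.1 y.down.1
  let inst : PartialOrder P :=
    { le := fun x y => x = y ∨ lt x y
      lt := lt
      le_refl := fun x => Or.inl rfl
      le_trans := by
        rintro x y z (rfl | h) (rfl | h')
        · exact Or.inl rfl
        · exact Or.inr h'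
        · exact Or.inr h
        · exact Or.inr (LayerLT.trans h h')
      lt_iff_le_not_ge := by
        intro x y
        constructor
        · intro h
          refine ⟨Or.inr h, ?_⟩
          rintro (rfl | h')
          · exact absurd (LayerLT.fst_lt h) (lt_irrefl _)
          · exact absurd (LayerLT.fst_lt h) (LayerLT.fst_lt h').not_gt
        · rintro ⟨rfl | h, h'⟩
          · exact absurd (Or.inl rfl) h'
          · exact h
      le_antisymm := by
        rintro x y (rfl | h) h'
        · rfl
        · rcases h' with rfl | h'
          · rfl
          · exact absurd (LayerLT.fst_lt h) (LayerLT.fst_lt h').not_gt }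
  refine ⟨P, inst, fun x => x.down.1, ?_, fun x => x.down.2, fun a ha => ⟨⟨⟨a, ha⟩⟩, rfl⟩,
    fun _ _ => Iff.rfl⟩
  intro x y h
  exact ULift.ext _ _ (Subtype.ext h)

namespace IsLayering

variable {P Q : Type u} [PartialOrder P] [PartialOrder Q] {n : ℕ} {w w' : ℕ → Bool}
  {pos : P → ℕ × Fin 3} {pos' : Q → ℕ × Fin 3}

theorem congr_word (h : IsLayering n w pos) (hw : ∀ k < n, w k = w' k) :
    IsLayering n w' pos := by
  refine ⟨h.injective, h.fst_le, h.exists_eq, fun x y => ?_⟩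
  rw [h.lt_iff]
  have h1 := h.fst_le y
  unfold LayerLT
  by_cases hk : (pos x).1 + 1 = (pos y).1
  · rw [hw (pos x).1 (by omega)]
  · simp [hk]

theorem comp_orderIso (h : IsLayering n w pos) (e : Q ≃o P) : IsLayering n w (pos ∘ e) := by
  refine ⟨h.injective.comp e.injective, fun x => h.fst_le _, fun a ha => ?_, fun x y => ?_⟩
  · obtain ⟨x, hx⟩ := h.exists_eq a ha
    exact ⟨e.symm x, by simpa using hx⟩
  · rw [← e.lt_iff_lt, h.lt_iff]
    rfl

theorem nonempty_orderIso (h : IsLayering n w pos) (h' : IsLayering n w pos') :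
    Nonempty (P ≃o Q) := by
  choose f hf using fun x => h'.exists_eq (pos x) (h.fst_le x)
  have hinj : Function.Injective f := fun x y hxy => h.injective (by rw [← hf x, ← hf y, hxy])
  have hsurj : Function.Surjective f := fun y => by
    obtain ⟨x, hx⟩ := h.exists_eq (pos' y) (h'.fst_le y)
    exact ⟨x, h'.injective (by rw [hf, hx])⟩
  refine ⟨⟨Equiv.ofBijective f ⟨hinj, hsurj⟩, fun {x y} => ?_⟩⟩
  change f x ≤ f y ↔ x ≤ y
  simp only [le_iff_eq_or_lt, hinj.eq_iff, h.lt_iff, h'.lt_iff, hf]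

theorem isRank (h : IsLayering n w pos) : IsRank fun x => (pos x).1 := by
  refine ⟨fun hxy => ((h.lt_iff _ _).1 hxy).fst_lt, fun x k hk => ?_⟩
  have hx := h.fst_le x
  cases hw : w k
  · obtain ⟨y, hy⟩ := h.exists_eq (k, (pos x).2) (by simp only; omega)
    refine ⟨y, ?_, by rw [hy]⟩
    rw [h.lt_iff, hy]
    exact Or.inr ⟨hk.symm, by simp [hw]⟩
  · obtain ⟨y, hy⟩ := h.exists_eq (k, (pos x).2 + 1) (by simp only; omega)
    refine ⟨y, ?_, by rw [hy]⟩
    rw [h.lt_iff, hy]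
    exact Or.inr ⟨hk.symm, by simp [hw]⟩

theorem hasHeight (h : IsLayering n w pos) : HasHeight P n := by
  refine h.isRank.hasHeight h.fst_le ?_
  obtain ⟨x, hx⟩ := h.exists_eq (n, 0) le_rfl
  exact ⟨x, by rw [hx]⟩

/-- The lower segment of a layered poset is layered. -/
theorem segment (h : IsLayering n w pos) {k : ℕ} (hk : k ≤ n) :
    IsLayering k w fun x : NiceSection.segment P 0 k => pos x := by
  refine ⟨h.injective.comp Subtype.val_injective, fun x => (h.isRank.mem_segment k x).1 x.2,
    fun a ha => ?_, fun x y => h.lt_iff x y⟩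
  obtain ⟨x, hx⟩ := h.exists_eq a (ha.trans hk)
  exact ⟨⟨x, (h.isRank.mem_segment k x).2 (by rw [hx]; exact ha)⟩, hx⟩

theorem isTwoRowed (h : IsLayering n w pos) {k l : ℕ} (hkl : k < l) (hl : l ≤ n)
    {E : Fin 3 → Fin 3 → Prop} (τ : Fin 3 → Fin 3) (hτ : Function.Injective τ)
    (hE : ∀ i j, E i j ↔ LayerLT w (k, i) (l, τ j)) : IsTwoRowed 3 E (levelPair P k l) := by
  choose f hf using fun a : Fin 3 × Fin 2 =>
    h.exists_eq (if a.2 = 0 then (k, a.1) else (l, τ a.1)) (by split <;> simp only <;> omega)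
  have key : ∀ b : Fin 2, b ≠ 0 → b = 1 := by decide
  refine isTwoRowed_of_injective f ?_ ?_ ?_
  · rintro ⟨i, b⟩ ⟨j, d⟩ hab
    have hab : pos (f (i, b)) = pos (f (j, d)) := by rw [hab]
    rw [hf, hf] at hab
    by_cases hb : b = 0 <;> by_cases hd : d = 0 <;> simp only [hb, hd, if_true, if_false,
      Prod.mk.injEq] at hab
    · simp [hb, hd, hab.2]
    · omega
    · omega
    · simp [key b hb, key d hd, hτ hab.2]
  · intro x
    rw [h.isRank.mem_levelPair]
    constructor
    · rintro (hx | hx)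
      · exact ⟨((pos x).2, 0), h.injective (by rw [hf]; simp [← hx])⟩
      · obtain ⟨j, hj⟩ := (Finite.injective_iff_surjective.1 hτ) (pos x).2
        exact ⟨(j, 1), h.injective (by rw [hf]; simp [← hx, hj])⟩
    · rintro ⟨a, rfl⟩
      rw [hf]
      split <;> simp
  · rintro ⟨i, b⟩ ⟨j, d⟩
    rw [h.lt_iff, hf, hf]
    by_cases hb : b = 0 <;> by_cases hd : d = 0
    · simp only [hb, hd, LayerLT]
      simp
    · simp [hb, key d hd, hE]
    · simp only [key b hb, hd, LayerLT]
      simp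
      omega
    · simp only [key b hb, key d hd, LayerLT]
      simp

theorem isCrown (h : IsLayering n w pos) {k : ℕ} (hk : k < n) (hw : w k = true) :
    IsCrown 3 (levelPair P k (k + 1)) := by
  -- In the standard crown the upper point `j` lies above `j` and `j + 1` and misses `j + 2`; a
  -- crown of `LayerLT` misses equal labels.
  refine ⟨by norm_num, h.isTwoRowed (Nat.lt_succ_self k) hk (fun j => j + 2)
    (add_left_injective _) ?_⟩
  simp only [LayerLT, hw]
  simp
  decide

theorem isThreeC (h : IsLayering n w pos) {k : ℕ} (hk : k < n) (hw : w k = false) :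
    IsThreeC (levelPair P k (k + 1)) := by
  refine h.isTwoRowed (Nat.lt_succ_self k) hk id Function.injective_id ?_
  simp [LayerLT, hw]

theorem isThreeThree (h : IsLayering n w pos) {k l : ℕ} (hk : k + 2 ≤ l) (hl : l ≤ n) :
    IsThreeThree (levelPair P k l) := by
  refine h.isTwoRowed (by omega) hl id Function.injective_id ?_
  simp [LayerLT, hk]

/-- A choice of points of consecutive levels, as points of the level pair. -/
theorem exists_levelPair (h : IsLayering n w pos) {k l : ℕ} {a : ℕ × Fin 3} (ha : a.1 ≤ n)
    (hkl : a.1 = k ∨ a.1 = l) : ∃ x : levelPair P k l, pos x = a := by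
  obtain ⟨x, hx⟩ := h.exists_eq a ha
  exact ⟨⟨x, (h.isRank.mem_levelPair k l x).2 (by rw [hx]; exact hkl)⟩, hx⟩

theorem not_isThreeThree (h : IsLayering n w pos) {k : ℕ} (hk : k < n) :
    ¬ IsThreeThree (levelPair P k (k + 1)) := by
  intro h3
  have hs := fun i : Fin 3 => h.exists_levelPair (k := k) (l := k + 1) (a := (k, i))
    (by simp only; omega) (Or.inl rfl)
  have ht := fun i : Fin 3 => h.exists_levelPair (k := k) (l := k + 1) (a := (k + 1, i))
    (by simp only; omega) (Or.inr rfl)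
  choose s hs using hs
  choose t ht using ht
  have hlt : ∀ i j, s i < t j ↔ LayerLT w (k, i) (k + 1, j) := fun i j => by
    rw [← hs, ← ht, ← h.lt_iff]
    rfl
  cases hw : w k
  · have h1 : s 0 < t 0 := (hlt _ _).2 (by simp [LayerLT, hw])
    have h2 : s 1 < t 1 := (hlt _ _).2 (by simp [LayerLT, hw])
    have := (hlt _ _).1 (h3.lt_of_lt_of_lt h1 h2)
    simp [LayerLT, hw] at this
  · have h1 : s 0 < t 1 := (hlt _ _).2 (by simp [LayerLT, hw])
    have h2 : s 1 < t 0 := (hlt _ _).2 (by simp [LayerLT, hw])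
    have := (hlt _ _).1 (h3.lt_of_lt_of_lt h1 h2)
    simp [LayerLT, hw] at this

theorem eq_true_of_isCrown (h : IsLayering n w pos) {k : ℕ} (hk : k < n)
    (hc : IsCrown 3 (levelPair P k (k + 1))) : w k = true := by
  by_contra hw
  obtain ⟨x, hx⟩ := h.exists_levelPair (k := k) (l := k + 1) (a := (k, 0))
    (by simp only; omega) (Or.inl rfl)
  obtain ⟨y, hy⟩ := h.exists_levelPair (k := k) (l := k + 1) (a := (k + 1, 0))
    (by simp only; omega) (Or.inr rfl)
  have hxy : x < y := (h.lt_iff _ _).2 (by rw [hx, hy]; simp [LayerLT, hw])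
  obtain ⟨z, hz, hne⟩ := hc.exists_lt_ne hxy
  apply hne
  have h1 : LayerLT w (pos x) (pos z) := (h.lt_iff _ _).1 hz
  have h2 := (h.isRank.mem_levelPair _ _ _).1 z.2
  refine Subtype.ext (h.injective ?_)
  rw [hx] at h1
  rw [hy]
  simp only [LayerLT, hw] at h1
  refine Prod.ext ?_ ?_
  · simp only
    omega
  · rcases h1 with h1 | h1
    · omega
    · simpa using h1.2

theorem eq_false_of_isThreeC (h : IsLayering n w pos) {k : ℕ} (hk : k < n)
    (hc : IsThreeC (levelPair P k (k + 1))) : w k = false := by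
  by_contra hw
  rw [Bool.not_eq_false] at hw
  obtain ⟨x, hx⟩ := h.exists_levelPair (k := k) (l := k + 1) (a := (k, 0))
    (by simp only; omega) (Or.inl rfl)
  obtain ⟨y, hy⟩ := h.exists_levelPair (k := k) (l := k + 1) (a := (k + 1, 1))
    (by simp only; omega) (Or.inr rfl)
  obtain ⟨z, hz⟩ := h.exists_levelPair (k := k) (l := k + 1) (a := (k + 1, 2))
    (by simp only; omega) (Or.inr rfl)
  have hxy : x < y := (h.lt_iff _ _).2 (by rw [hx, hy]; simp [LayerLT, hw])
  have hxz : x < z := (h.lt_iff _ _).2 (by rw [hx, hz]; simp [LayerLT, hw])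
  have := hc.eq_of_lt_of_lt hxy hxz
  rw [this, hz] at hy
  simp at hy

theorem hasCode_iff (h : IsLayering n w pos) (c : List (Fin 2)) :
    HasCode P c ↔ c = codeOf n w := by
  have key : ∀ b : Fin 2, b ≠ 0 → b = 1 := by decide
  constructor
  · rintro ⟨h1, h2⟩
    have hn := h1.unique h.hasHeight
    refine List.ext_getElem (by rw [hn, length_codeOf]) fun k hk hk' => ?_
    simp only [codeOf, List.getElem_map, List.getElem_range]
    by_cases hc : c.get ⟨k, hk⟩ = 0
    · rw [h.eq_false_of_isThreeC (hn ▸ hk) ((h2 k hk).2 hc)]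
      exact hc
    · rw [h.eq_true_of_isCrown (hn ▸ hk) ((h2 k hk).1 (key _ hc))]
      exact key _ hc
  · rintro rfl
    refine ⟨by rw [length_codeOf]; exact h.hasHeight, fun k hk => ?_⟩
    rw [length_codeOf] at hk
    simp only [codeOf, List.getElem_map, List.getElem_range]
    cases hw : w k
    · exact ⟨by simp, fun _ => h.isThreeC hk hw⟩
    · exact ⟨fun _ => h.isCrown hk hw, by simp⟩

end IsLayering
-- Layered posets and the class `𝔑₂`
/-- The number of crowns below level `k`, modulo three. -/
def twist (w : ℕ → Bool) : ℕ → Fin 3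
  | 0 => 0
  | k + 1 => twist w k + if w k then 1 else 0

namespace IsLayering

variable {P : Type u} [PartialOrder P] {n : ℕ} {w : ℕ → Bool} {pos : P → ℕ × Fin 3}

/-- Equal labels are incomparable across a crown, so the chains of a section cannot follow the
labels. Turning by one at every crown repairs this: the only missing comparability is then the one
with `i = j + 1`. -/
theorem isSection (h : IsLayering n w pos) (hn : 1 ≤ n) : IsSection P := by
  right
  refine ⟨n, hn, h.hasHeight, ?_, fun k hk => h.not_isThreeThree hk⟩
  choose c hc using fun a : Fin (n + 1) × Fin 3 =>
    h.exists_eq ((a.1 : ℕ), a.2 + twist w a.1) (by simp only; omega)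
  have hinj : Function.Injective c := by
    rintro ⟨k, i⟩ ⟨l, j⟩ hab
    have hab : pos (c (k, i)) = pos (c (l, j)) := by rw [hab]
    rw [hc, hc, Prod.mk.injEq] at hab
    obtain ⟨h1, h2⟩ := hab
    obtain rfl := Fin.ext h1
    simpa using h2
  have hsurj : Function.Surjective c := by
    intro x
    refine ⟨(⟨(pos x).1, Nat.lt_succ_of_le (h.fst_le x)⟩, (pos x).2 - twist w (pos x).1), ?_⟩
    apply h.injective
    rw [hc]
    simp
  have hlt : ∀ a b, c a < c b ↔ (a.1 : ℕ) + 2 ≤ b.1 ∨ ((a.1 : ℕ) + 1 = b.1 ∧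
      if w a.1 then a.2 ≠ b.2 + 1 else a.2 = b.2) := by
    rintro ⟨k, i⟩ ⟨l, j⟩
    rw [h.lt_iff, hc, hc]
    unfold LayerLT
    refine or_congr_right (and_congr_right fun hkl => ?_)
    simp only at hkl ⊢
    rw [← hkl, twist]
    generalize twist w k = s
    cases w k
    · simp
    · simp only [if_true, ne_eq]
      revert i j s
      decide
  refine ⟨Equiv.ofBijective c ⟨hinj, hsurj⟩, ?_, ?_, ?_⟩
  · intro j k l hkl
    change c (k, j) < c (l, j)
    rw [hlt]
    have : (k : ℕ) < l := hkl
    by_cases h2 : (k : ℕ) + 2 ≤ l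
    · exact Or.inl h2
    · refine Or.inr ⟨by simp only; omega, ?_⟩
      simp
  · intro k i j hij
    change c (k, i) ≤ c (k, j) at hij
    rcases hij.eq_or_lt with hij | hij
    · exact (Prod.mk.injEq _ _ _ _ ▸ hinj hij).2
    · rw [hlt] at hij
      simp at hij
  · intro k i l j
    change c (k, i) ≤ c (l, j) ↔ c (k, i + 1) ≤ c (l, j + 1)
    simp only [le_iff_eq_or_lt, hinj.eq_iff, hlt, Prod.mk.injEq, add_left_inj, ne_eq]

theorem covBy_of_succ (h : IsLayering n w pos) {x y : P} (hxy : x < y)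
    (hk : (pos x).1 + 1 = (pos y).1) : x ⋖ y := by
  refine ⟨hxy, fun z hxz hzy => ?_⟩
  have h1 := ((h.lt_iff _ _).1 hxz).fst_lt
  have h2 := ((h.lt_iff _ _).1 hzy).fst_lt
  omega

/-- Two points at distance two form a covering pair iff no intermediate point links them. -/
theorem covBy_of_succ_succ (h : IsLayering n w pos) {x y : P}
    (hk : (pos x).1 + 2 = (pos y).1)
    (hz : ∀ i, LayerLT w (pos x) ((pos x).1 + 1, i) → ¬ LayerLT w ((pos x).1 + 1, i) (pos y)) :
    x ⋖ y := by
  refine ⟨(h.lt_iff _ _).2 (Or.inl hk.le), fun z hxz hzy => ?_⟩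
  rw [h.lt_iff] at hxz hzy
  have h1 := hxz.fst_lt
  have h2 := hzy.fst_lt
  have h3 : pos z = ((pos x).1 + 1, (pos z).2) := Prod.ext (by simp only; omega) rfl
  rw [h3] at hxz hzy
  exact hz _ hxz hzy

/-- A point just above a crown has two lower neighbours one level down. Just above type `3C` it has
only one there, but a point two levels down that is not below this neighbour is a further lower
cover. That level exists because the bottom pair is a crown. The statement on upper covers is dual.
-/
theorem not_existsUnique_lower (h : IsLayering n w pos) (h0 : w 0 = true) (x : P) :
    ¬ ∃! y, y ⋖ x := by
  rintro ⟨y, hy, huniq⟩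
  obtain ⟨k, hk⟩ : ∃ k, (pos x).1 = k + 1 := by
    have := ((h.lt_iff _ _).1 hy.1).fst_lt
    exact ⟨(pos x).1 - 1, by omega⟩
  have hx := h.fst_le x
  have two : ∀ a b : ℕ × Fin 3, a ≠ b → (∃ z, pos z = a ∧ z ⋖ x) → (∃ z, pos z = b ∧ z ⋖ x) →
      False := by
    rintro _ _ hab ⟨z, rfl, hz⟩ ⟨z', rfl, hz'⟩
    exact hab (by rw [huniq z hz, huniq z' hz'])
  cases hw : w k
  · obtain ⟨m, rfl⟩ : ∃ m, k = m + 1 := by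
      cases k with
      | zero => rw [h0] at hw; cases hw
      | succ m => exact ⟨m, rfl⟩
    refine two (m + 1, (pos x).2) (m, if w m then (pos x).2 else (pos x).2 + 1) ?_ ?_ ?_
    · intro hab
      have := congrArg Prod.fst hab
      simp at this
    · obtain ⟨z, hz⟩ := h.exists_eq (m + 1, (pos x).2) (by simp only; omega)
      refine ⟨z, hz, h.covBy_of_succ ((h.lt_iff _ _).2 (Or.inr ?_)) ?_⟩ <;> simp [hz, hw, hk]
    · obtain ⟨z, hz⟩ := h.exists_eq (m, if w m then (pos x).2 else (pos x).2 + 1)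
        (by simp only; omega)
      refine ⟨z, hz, h.covBy_of_succ_succ ?_ ?_⟩
      · simp [hz, hk]
      · intro i
        rw [hz]
        simp only [LayerLT, hw, hk]
        cases w m <;> simp
        · rintro rfl
          simp
        · exact fun h1 h2 => h1 h2.symm
  · refine two (k, (pos x).2 + 1) (k, (pos x).2 + 2) (by simp) ?_ ?_
    all_goals
      refine (h.exists_eq _ (by simp only; omega)).imp fun z hz =>
        ⟨hz, h.covBy_of_succ ((h.lt_iff _ _).2 (Or.inr ?_)) ?_⟩ <;> simp [hz, hw, hk]

theorem not_existsUnique_upper (h : IsLayering n w pos) (h1 : w (n - 1) = true) (x : P) :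
    ¬ ∃! y, x ⋖ y := by
  rintro ⟨y, hy, huniq⟩
  obtain ⟨k, hk⟩ : ∃ k, (pos x).1 = k := ⟨_, rfl⟩
  have hx : k + 1 ≤ n := by
    have := ((h.lt_iff _ _).1 hy.1).fst_lt
    have := h.fst_le y
    omega
  have two : ∀ a b : ℕ × Fin 3, a ≠ b → (∃ z, pos z = a ∧ x ⋖ z) → (∃ z, pos z = b ∧ x ⋖ z) →
      False := by
    rintro _ _ hab ⟨z, rfl, hz⟩ ⟨z', rfl, hz'⟩
    exact hab (by rw [huniq z hz, huniq z' hz'])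
  cases hw : w k
  · have hkn : k + 2 ≤ n := by
      by_contra hcon
      rw [show n - 1 = k by omega, hw] at h1
      cases h1
    refine two (k + 1, (pos x).2) (k + 2, if w (k + 1) then (pos x).2 else (pos x).2 + 1) ?_ ?_ ?_
    · intro hab
      have := congrArg Prod.fst hab
      simp at this
    · obtain ⟨z, hz⟩ := h.exists_eq (k + 1, (pos x).2) (by simp only; omega)
      refine ⟨z, hz, h.covBy_of_succ ((h.lt_iff _ _).2 (Or.inr ?_)) ?_⟩ <;> simp [hz, hw, hk]
    · obtain ⟨z, hz⟩ := h.exists_eq (k + 2, if w (k + 1) then (pos x).2 else (pos x).2 + 1) hkn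
      refine ⟨z, hz, h.covBy_of_succ_succ ?_ ?_⟩
      · simp [hz, hk]
      · intro i
        rw [hz]
        simp only [LayerLT, hw, hk]
        cases w (k + 1) <;> simp
        · rintro rfl h2
          simp at h2
        · exact fun h2 => h2.symm
  · refine two (k + 1, (pos x).2 + 1) (k + 1, (pos x).2 + 2) (by simp) ?_ ?_
    all_goals
      refine (h.exists_eq _ (by simp only; omega)).imp fun z hz =>
        ⟨hz, h.covBy_of_succ ((h.lt_iff _ _).2 (Or.inr ?_)) ?_⟩ <;> simp [hz, hw, hk]

theorem isN2 (h : IsLayering n w pos) (hn : 2 ≤ n) (h0 : w 0 = true) (h1 : w (n - 1) = true) :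
    IsN2 P := by
  refine ⟨⟨h.isSection (by omega), fun x hx => ?_⟩, n, hn, h.hasHeight, ?_, ?_⟩
  · exact hx.elim (h.not_existsUnique_lower h0 x) (h.not_existsUnique_upper h1 x)
  · exact fun k hk => h.isThreeThree le_rfl hk
  · intro e he
    by_contra hlt
    obtain rfl | rfl : e = 0 ∨ e = 1 := by omega
    · obtain ⟨f, hf⟩ := he 0 (by omega)
      have h2 := (hf (0, 0) (0, 1)).2 ⟨rfl, rfl, trivial⟩
      have h3 := (h.isRank.mem_levelPair _ _ _).1 (f (0, 0)).2
      have h4 := (h.isRank.mem_levelPair _ _ _).1 (f (0, 1)).2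
      have h5 := h.isRank.lt_of_lt (Subtype.coe_lt_coe.2 h2)
      omega
    · exact h.not_isThreeThree (by omega) (he 0 (by omega))

/-- A layered poset without points having exactly one lower cover starts with a crown. -/
theorem word_zero (h : IsLayering n w pos) (hn : 1 ≤ n) (hirr : ∀ x : P, ¬ ∃! y, y ⋖ x) :
    w 0 = true := by
  by_contra hw
  obtain ⟨x, hx⟩ := h.exists_eq (1, 0) hn
  obtain ⟨y, hy⟩ := h.exists_eq (0, 0) (Nat.zero_le _)
  refine hirr x ⟨y, ?_, fun z hz => ?_⟩
  · exact h.covBy_of_succ ((h.lt_iff _ _).2 (by rw [hx, hy]; simp [LayerLT, hw])) (by simp [hx, hy])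
  · have hz := (h.lt_iff _ _).1 hz.1
    rw [hx] at hz
    apply h.injective
    rw [hy]
    have h1 := hz.fst_lt
    have h2 : (pos z).1 = 0 := by simp only at h1; omega
    rcases hz with hz | hz
    · simp only at hz; omega
    · rw [h2] at hz
      exact Prod.ext h2 (by simpa [hw] using hz.2)

end IsLayering

/-- Every member of `𝔑₂` is layered and starts with a crown. -/
theorem IsN2.exists_isLayering {P : Type u} [PartialOrder P] (hP : IsN2 P) :
    ∃ (n : ℕ) (w : ℕ → Bool) (pos : P → ℕ × Fin 3), 2 ≤ n ∧ w 0 = true ∧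
      IsLayering n w pos := by
  obtain ⟨⟨hsec, hirr⟩, h, h2, hh, hor, -⟩ := hP
  rcases hsec with ⟨-, hanti⟩ | ⟨h', -, hh', ⟨c, hchain, hac, hshift⟩, h33⟩
  · exfalso
    have : Order.krullDim P ≤ 0 := by
      refine iSup_le fun p => ?_
      by_contra hp
      have hp : 0 < p.length := by
        by_contra h0
        exact hp (by rw [Nat.eq_zero_of_not_pos h0]; rfl)
      have := p.step ⟨0, hp⟩
      exact this.ne (hanti _ _ this.le)
    rw [show Order.krullDim P = h from hh] at this
    have : h ≤ 0 := by exact_mod_cast this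
    omega
  obtain rfl := hh.unique hh'
  have hshift' : ∀ (k l : Fin (h + 1)) (i j d : Fin 3),
      c (k, i) ≤ c (l, j) ↔ c (k, i + d) ≤ c (l, j + d) := by
    intro k l i j d
    have e0 : ∀ i : Fin 3, i + 0 = i := by decide
    have e2 : ∀ i : Fin 3, i + 2 = i + 1 + 1 := by decide
    fin_cases d
    · simp
    · exact hshift k i l j
    · simp only [Fin.reduceFinMk, e2]
      rw [hshift, hshift]
  have hlt : ∀ a b, c a < c b → a.1 < b.1 := by
    rintro ⟨k, i⟩ ⟨l, j⟩ hab
    by_contra hkl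
    rcases (not_lt.1 hkl).eq_or_lt with he | he
    · simp only at he
      subst he
      exact hab.ne (by rw [hac _ _ _ hab.le])
    · have h3 : c (l, j) < c (k, j) := hchain j he
      have h4 := hac _ _ _ (hab.trans h3).le
      subst h4
      exact absurd hab h3.not_gt
  have hrank : IsRank fun x => ((c.symm x).1 : ℕ) := by
    refine ⟨fun {x y} hxy => hlt _ _ (by simpa using hxy), fun x k hk => ?_⟩
    have hlast := (c.symm x).1.2
    refine ⟨c (⟨k, by omega⟩, (c.symm x).2), ?_, by simp⟩
    have := hchain (c.symm x).2 (a := ⟨k, by omega⟩) (b := (c.symm x).1)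
      (by rw [Fin.lt_def]; simp only; omega)
    simpa using this
  have hmem : ∀ (k l : ℕ) (a : Fin (h + 1) × Fin 3), ((a.1 : ℕ) = k ∨ (a.1 : ℕ) = l) →
      c a ∈ levelPair P k l := fun k l a ha => (hrank.mem_levelPair k l _).2 (by simpa using ha)
  -- Horizon two settles the levels `k` and `k + 2`; the chains carry the comparabilities further
  -- up.
  have htwo : ∀ (k l : Fin (h + 1)) (i j : Fin 3), (k : ℕ) + 2 ≤ l → c (k, i) < c (l, j) := by
    intro k l i j hkl
    have hk2 : (k : ℕ) + 2 ≤ h := by omega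
    let m : Fin (h + 1) := ⟨k + 2, by omega⟩
    have hkm : k < m := by rw [Fin.lt_def]; simp [m]
    have h3 := hor k hk2
    have h4 := h3.lt_of_lt_of_lt
      (x := ⟨c (k, i), hmem _ _ _ (Or.inl rfl)⟩) (y := ⟨c (m, i), hmem _ _ _ (Or.inr rfl)⟩)
      (z := ⟨c (k, j), hmem _ _ _ (Or.inl rfl)⟩) (t := ⟨c (m, j), hmem _ _ _ (Or.inr rfl)⟩)
      (hchain i hkm) (hchain j hkm)
    have h4 : c (k, i) < c (m, j) := h4
    exact h4.trans_le ((hchain j).monotone (by rw [Fin.le_def]; exact hkl))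
  -- The shifts `d` relating level `k` to level `k + 1`; by rotation they do not depend on the
  -- starting point.
  let r : ℕ → Fin 3 → Prop := fun k d => ∃ hk : k < h,
    c (⟨k, by omega⟩, 0) < c (⟨k + 1, by omega⟩, d)
  have hr : ∀ (k : ℕ) (hk : k < h) (i d : Fin 3),
      c (⟨k, by omega⟩, i) < c (⟨k + 1, by omega⟩, i + d) ↔ r k d := by
    intro k hk i d
    have hne : ∀ i j, c (⟨k, by omega⟩, i) ≠ c (⟨k + 1, by omega⟩, j) := by
      intro i j hij
      simpa using c.injective hij
    have := hshift' ⟨k, by omega⟩ ⟨k + 1, by omega⟩ 0 d i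
    simp only [zero_add, add_comm d i] at this
    rw [lt_iff_le_and_ne, ← this]
    constructor
    · exact fun hh => ⟨hk, lt_of_le_of_ne hh.1 (hne _ _)⟩
    · exact fun ⟨_, hh⟩ => ⟨hh.le, hne _ _⟩
  have hr0 : ∀ k < h, r k 0 := fun k hk =>
    ⟨hk, hchain 0 (by rw [Fin.lt_def]; simp)⟩
  have hr12 : ∀ k < h, ¬ (r k 1 ∧ r k 2) := by
    rintro k hk ⟨h1, h2⟩
    apply h33 k hk
    have hall : ∀ d, r k d := by
      intro d
      fin_cases d
      exacts [hr0 k hk, h1, h2]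
    have hval : ∀ b : Fin 2, (b : ℕ) ≤ 1 := by decide
    refine isTwoRowed_of_injective (fun a => c (⟨k + a.2, by have := hval a.2; omega⟩, a.1))
      ?_ ?_ ?_
    · rintro ⟨i, b⟩ ⟨j, d⟩ hab
      have := c.injective hab
      simp only [Prod.mk.injEq, Fin.mk.injEq, Nat.add_left_cancel_iff] at this
      exact Prod.ext this.2 (Fin.ext this.1)
    · intro x
      rw [hrank.mem_levelPair]
      constructor
      · rintro (hx | hx)
        · exact ⟨((c.symm x).2, 0), by simp [← hx]⟩
        · exact ⟨((c.symm x).2, 1), by simp [← hx]⟩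
      · rintro ⟨⟨i, b⟩, rfl⟩
        have := hval b
        simp only [Equiv.symm_apply_apply]
        omega
    · rintro ⟨i, b⟩ ⟨j, d⟩
      constructor
      · intro hab
        have := hlt _ _ hab
        rw [Fin.lt_def] at this
        have h3 := hval b
        have h4 := hval d
        simp only at this
        refine ⟨Fin.ext ?_, Fin.ext ?_, trivial⟩
        · change (b : ℕ) = 0
          omega
        · change (d : ℕ) = 1
          omega
      · rintro ⟨h3, h4, -⟩
        simp only at h3 h4
        subst h3 h4
        have := (hr k hk i (j - i)).2 (hall _)
        simpa using this
  classical
  let w : ℕ → Bool := fun k => decide (r k 1 ∨ r k 2)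
  -- The shift that has to become equality of labels: the missing one at a crown, and 0 at type
  -- `3C`. Subtracting the partial sums `s` achieves this on all levels.
  let t : ℕ → Fin 3 := fun k => if r k 1 then 2 else if r k 2 then 1 else 0
  let s : ℕ → Fin 3 := fun k => ∑ l ∈ Finset.range k, t l
  have hpos : IsLayering h w fun x =>
      (((c.symm x).1 : ℕ), (c.symm x).2 - s (c.symm x).1) := by
    refine ⟨?_, fun x => ?_, ?_, ?_⟩
    · intro x y hxy
      simp only [Prod.mk.injEq] at hxy
      obtain ⟨h1, h2⟩ := hxy
      rw [h1] at h2
      exact c.symm.injective (Prod.ext (Fin.ext h1) (sub_left_injective h2))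
    · have := (c.symm x).1.2
      simp only
      omega
    · rintro ⟨k, i⟩ hk
      exact ⟨c (⟨k, Nat.lt_succ_of_le hk⟩, i + s k), by simp⟩
    · intro x y
      obtain ⟨⟨k, i⟩, rfl⟩ := c.surjective x
      obtain ⟨⟨l, j⟩, rfl⟩ := c.surjective y
      simp only [Equiv.symm_apply_apply, LayerLT]
      by_cases h1 : (k : ℕ) + 2 ≤ l
      · simp [h1, htwo k l i j h1]
      by_cases h3 : (k : ℕ) + 1 = l
      · have hk : (k : ℕ) < h := by omega
        have h4 := hr k hk i (j - i)
        have h5 : (⟨(k : ℕ) + 1, by omega⟩ : Fin (h + 1)) = l := Fin.ext h3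
        rw [add_sub_cancel, h5] at h4
        have h4 : c (k, i) < c (l, j) ↔ r k (j - i) := h4
        rw [h4]
        have hs : s l = s k + t k := by
          rw [← h3]
          exact Finset.sum_range_succ _ _
        rw [hs]
        have hk0 := hr0 k hk
        have hk12 := hr12 k hk
        simp only [h3, true_and, w, t]
        generalize s k = σ
        have key : ∀ i j σ e : Fin 3, i - σ = j - (σ + e) ↔ j - i = e := by decide
        rw [ne_eq, key]
        have h012 : ∀ d : Fin 3, d = 0 ∨ d = 1 ∨ d = 2 := by decide
        by_cases hr1 : r k 1
        · have hr2 : ¬ r k 2 := fun hr2 => hk12 ⟨hr1, hr2⟩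
          simp only [hr1, hr2, true_or, decide_true, if_true]
          rcases h012 (j - i) with hd | hd | hd <;> rw [hd] <;> simp [h1, hk0, hr1, hr2]
        · by_cases hr2 : r k 2
          · simp only [hr1, hr2, or_true, decide_true, if_true, if_false]
            rcases h012 (j - i) with hd | hd | hd <;> rw [hd] <;> simp [h1, hk0, hr1, hr2]
          · simp only [hr1, hr2, or_false, decide_false, if_false]
            rcases h012 (j - i) with hd | hd | hd <;> rw [hd] <;> simp [h1, hk0, hr1, hr2]
      · have : ¬ c (k, i) < c (l, j) := by
          intro hcon
          have := hlt _ _ hcon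
          rw [Fin.lt_def] at this
          simp only at this
          omega
        simp [h1, h3, this]
  exact ⟨h, w, _, h2, hpos.word_zero (by omega) fun x hx => hirr x (Or.inl hx), hpos⟩

/-- The members of `𝔑₂^LS` are layered posets starting with a crown. -/
theorem IsN2LS.exists_isLayering {Q : Type u} [PartialOrder Q] (hQ : IsN2LS Q) {n : ℕ}
    (hQn : HasHeight Q n) :
    ∃ (w : ℕ → Bool) (pos : Q → ℕ × Fin 3), w 0 = true ∧ IsLayering n w pos := by
  obtain ⟨P, _, hP, h, k, hh, hk, ⟨e⟩⟩ := hQ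
  obtain ⟨m, w, pos, -, h0, hpos⟩ := hP.exists_isLayering
  obtain rfl := hh.unique hpos.hasHeight
  have h1 := (hpos.segment hk).comp_orderIso e
  obtain rfl := hQn.unique h1.hasHeight
  exact ⟨w, _, h0, h1⟩

theorem exists_isN2LS (n : ℕ) (w : ℕ → Bool) (h0 : w 0 = true) :
    ∃ (Q : Type u) (_ : PartialOrder Q) (pos : Q → ℕ × Fin 3),
      IsN2LS Q ∧ IsLayering n w pos := by
  -- Two more crowns on top guarantee height at least two and exclude unique upper covers.
  let w' : ℕ → Bool := fun k => if k < n then w k else true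
  obtain ⟨P, _, pos, hpos⟩ := NiceSection.exists_isLayering.{u} (n + 2) w'
  refine ⟨segment P 0 n, inferInstance, _, ⟨P, inferInstance, ?_, n + 2, n, hpos.hasHeight,
    by omega, ⟨OrderIso.refl _⟩⟩,
    (hpos.segment (k := n) (by omega)).congr_word fun k hk => by simp [w', hk]⟩
  refine hpos.isN2 (by omega) ?_ ?_
  · simp [w', h0]
  · simp [w']

theorem IsN2.isN2LS {P : Type u} [PartialOrder P] (hP : IsN2 P) : IsN2LS P := by
  obtain ⟨n, w, pos, -, -, hpos⟩ := hP.exists_isLayering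
  have h1 := hpos.segment le_rfl
  obtain ⟨e⟩ := hpos.nonempty_orderIso h1
  exact ⟨P, inferInstance, hP, n, n, hpos.hasHeight, le_rfl, ⟨e⟩⟩

/-! ### Retractions onto 4-crown stacks as folds -/

/-- A retraction of `P` onto an ordinal sum of `m + 1` two-element antichains `{g i b | b}`,
`i ≤ m`, written in terms of the index `s x` and the colour `κ x` of the image of `x`. -/
structure IsFold {P : Type u} [PartialOrder P] (m : ℕ) (s : P → ℕ) (κ : P → Bool)
    (g : ℕ → Bool → P) : Prop where
  index_le : ∀ x, s x ≤ m
  index_section : ∀ i ≤ m, ∀ b, s (g i b) = i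
  colour_section : ∀ i ≤ m, ∀ b, κ (g i b) = b
  section_lt : ∀ i < m, ∀ b d, g i b < g (i + 1) d
  mono : ∀ x y, x < y → s x < s y ∨ (s x = s y ∧ κ x = κ y)

/-- For `n = 2` the crown relation holds between all pairs, so a 4-crown is the ordinal sum of two
two-element antichains. -/
theorem IsCrown.levels_of_two {R : Type u} [PartialOrder R] {k : ℕ}
    (h : IsCrown 2 (levelPair R k (k + 1))) :
    (∃ a b : R, a ≠ b ∧ ∀ x, x ∈ level R k ↔ x = a ∨ x = b) ∧
    (∃ a b : R, a ≠ b ∧ ∀ x, x ∈ level R (k + 1) ↔ x = a ∨ x = b) ∧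
    ∀ x ∈ level R k, ∀ y ∈ level R (k + 1), x < y := by
  obtain ⟨-, e, he⟩ := h
  have hE : ∀ i j : Fin 2, i = j ∨ (i : ℕ) = ((j : ℕ) + 1) % 2 := by decide
  simp only [hE, and_true] at he
  have hE2 : ∀ i : Fin 2, i = 0 ∨ i = 1 := by decide
  have hlow : ∀ i, (e (i, 0)).1 ∈ level R k := by
    intro i
    rcases (e (i, 0)).2 with h | h
    · exact h
    · have hlt : (e (i, 0)).1 < (e (0, 1)).1 := (he (i, 0) (0, 1)).2 ⟨rfl, rfl⟩
      rcases (e (0, 1)).2 with h' | h'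
      · have := level_lt_of_lt h h' hlt
        omega
      · have := level_lt_of_lt h h' hlt
        omega
  have hup : ∀ i, (e (i, 1)).1 ∈ level R (k + 1) := by
    intro i
    rcases (e (i, 1)).2 with h | h
    · have hlt : (e (0, 0)).1 < (e (i, 1)).1 := (he (0, 0) (i, 1)).2 ⟨rfl, rfl⟩
      have := level_lt_of_lt (hlow 0) h hlt
      omega
    · exact h
  have hlow' : ∀ x ∈ level R k, ∃ i, x = (e (i, 0)).1 := by
    intro x hx
    obtain ⟨⟨i, b⟩, hi⟩ := e.surjective ⟨x, Or.inl hx⟩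
    rcases hE2 b with rfl | rfl
    · exact ⟨i, by rw [hi]⟩
    · have := hup i
      rw [hi] at this
      have := level_unique hx this
      omega
  have hup' : ∀ x ∈ level R (k + 1), ∃ i, x = (e (i, 1)).1 := by
    intro x hx
    obtain ⟨⟨i, b⟩, hi⟩ := e.surjective ⟨x, Or.inr hx⟩
    rcases hE2 b with rfl | rfl
    · have := hlow i
      rw [hi] at this
      have := level_unique hx this
      omega
    · exact ⟨i, by rw [hi]⟩
  refine ⟨⟨e (0, 0), e (1, 0), ?_, fun x => ⟨fun hx => ?_, ?_⟩⟩,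
    ⟨e (0, 1), e (1, 1), ?_, fun x => ⟨fun hx => ?_, ?_⟩⟩, fun x hx y hy => ?_⟩
  · intro h
    simpa using e.injective (Subtype.ext h)
  · obtain ⟨i, rfl⟩ := hlow' x hx
    rcases hE2 i with rfl | rfl <;> simp
  · rintro (rfl | rfl) <;> exact hlow _
  · intro h
    simpa using e.injective (Subtype.ext h)
  · obtain ⟨i, rfl⟩ := hup' x hx
    rcases hE2 i with rfl | rfl <;> simp
  · rintro (rfl | rfl) <;> exact hup _
  · obtain ⟨i, rfl⟩ := hlow' x hx
    obtain ⟨j, rfl⟩ := hup' y hy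
    exact (he (i, 0) (j, 1)).2 ⟨rfl, rfl⟩

theorem HasFourCrownStackRetract.exists_isFold {P : Type u} [PartialOrder P]
    (hP : HasFourCrownStackRetract P) :
    ∃ (m : ℕ) (s : P → ℕ) (κ : P → Bool) (g : ℕ → Bool → P), 1 ≤ m ∧ IsFold m s κ g := by
  obtain ⟨R, ⟨r, hidem, hrange⟩, m, hm, hheight, hcrown, -⟩ := hP
  have hlev : ∀ k ≤ m, ∃ g : Bool → R, Function.Injective g ∧
      ∀ x, x ∈ level R k ↔ ∃ b, g b = x := by
    have key : ∀ k, (∃ a b : R, a ≠ b ∧ ∀ x, x ∈ level R k ↔ x = a ∨ x = b) →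
        ∃ g : Bool → R, Function.Injective g ∧ ∀ x, x ∈ level R k ↔ ∃ b, g b = x := by
      rintro k ⟨a, b, hab, h⟩
      refine ⟨fun c => cond c b a, ?_, fun x => ?_⟩
      · rintro (_ | _) (_ | _) h
        exacts [rfl, absurd h hab, absurd h.symm hab, rfl]
      · simp [h, eq_comm]
    intro k hk
    apply key
    by_cases hkm : k < m
    · exact (hcrown k hkm).levels_of_two.1
    · obtain ⟨l, rfl⟩ : ∃ l, k = l + 1 := ⟨k - 1, by omega⟩
      exact (hcrown l (by omega)).levels_of_two.2.1
  obtain ⟨g0, -⟩ := hlev 0 (Nat.zero_le _)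
  have : Nonempty R := ⟨g0 true⟩
  classical
  choose! g hginj hg using hlev
  choose lev hlevle hlev using hheight.exists_mem_level
  have hlevg : ∀ i ≤ m, ∀ b, lev (g i b) = i := fun i hi b =>
    level_unique (hlev _) ((hg i hi _).2 ⟨b, rfl⟩)
  let q : P → R := fun x => ⟨r x, hrange ▸ Set.mem_range_self x⟩
  have hq : ∀ x : R, q x = x := by
    rintro ⟨x, hx⟩
    rw [← hrange] at hx
    obtain ⟨y, rfl⟩ := hx
    exact Subtype.ext (hidem y)
  refine ⟨m, fun x => lev (q x), fun x => decide (q x = g (lev (q x)) true),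
    fun i b => g i b, hm, fun x => hlevle _, ?_, ?_, ?_, ?_⟩
  · intro i hi b
    rw [hq, hlevg i hi]
  · intro i hi b
    simp only [hq, hlevg i hi, (hginj i hi).eq_iff]
    cases b <;> rfl
  · intro i hi b d
    exact (hcrown i hi).levels_of_two.2.2 _ ((hg i hi.le _).2 ⟨b, rfl⟩) _
      ((hg (i + 1) hi _).2 ⟨d, rfl⟩)
  · intro x y hxy
    have hle : q x ≤ q y := r.monotone hxy.le
    rcases hle.eq_or_lt with h | h
    · exact Or.inr (by rw [h]; exact ⟨rfl, rfl⟩)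
    · exact Or.inl (level_lt_of_lt (hlev _) (hlev _) h)

namespace IsFold

variable {P : Type u} [PartialOrder P] {m : ℕ} {s : P → ℕ} {κ : P → Bool} {g : ℕ → Bool → P}

theorem section_lt_of_lt (h : IsFold m s κ g) {i j : ℕ} (hij : i < j) (hj : j ≤ m) (b d : Bool) :
    g i b < g j d := by
  induction j, hij using Nat.le_induction generalizing d with
  | base => exact h.section_lt i hj b d
  | succ j _ ih => exact (ih (by omega) true).trans (h.section_lt j hj true d)

/-- The retraction is `x ↦ g (s x) (κ x)`. It is monotone because `mono` mirrors the order of the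
ordinal sum, and idempotent because `g` is a section of index and colour. The index is a rank on the
image. -/
theorem hasFourCrownStackRetract (h : IsFold m s κ g) (hm : 1 ≤ m) :
    HasFourCrownStackRetract P := by
  have hfix : ∀ i ≤ m, ∀ b, g (s (g i b)) (κ (g i b)) = g i b := fun i hi b => by
    rw [h.index_section i hi, h.colour_section i hi]
  let r : P →o P :=
    ⟨fun x => g (s x) (κ x), fun x y hxy => by
      rcases hxy.eq_or_lt with rfl | hlt
      · exact le_rfl
      · rcases h.mono x y hlt with h1 | ⟨h1, h2⟩
        · exact (h.section_lt_of_lt h1 (h.index_le y) _ _).le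
        · simp only [h1, h2, le_refl]⟩
  have hR : ∀ i ≤ m, ∀ b, g i b ∈ Set.range r := fun i hi b => ⟨g i b, hfix i hi b⟩
  have hR' : ∀ x : Set.range r, ∃ b, g (s x.1) b = x.1 := by
    rintro ⟨x, y, rfl⟩
    refine ⟨κ y, ?_⟩
    change g (s (g (s y) (κ y))) (κ y) = g (s y) (κ y)
    rw [h.index_section _ (h.index_le y)]
  have hrank : IsRank fun x : Set.range r => s x.1 := by
    refine ⟨fun {x y} hxy => ?_, fun x k hk => ?_⟩
    · rcases h.mono _ _ (Subtype.coe_lt_coe.2 hxy) with h1 | ⟨h1, h2⟩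
      · exact h1
      · obtain ⟨b, hb⟩ := hR' x
        obtain ⟨d, hd⟩ := hR' y
        rw [← hb, ← hd, h.colour_section _ (h.index_le _),
          h.colour_section _ (h.index_le _)] at h2
        refine absurd (Subtype.ext ?_) hxy.ne
        rw [← hb, ← hd, h1, h2]
    · have hx := h.index_le x.1
      obtain ⟨b, hb⟩ := hR' x
      refine ⟨⟨g k true, hR k (by omega) _⟩, ?_, h.index_section k (by omega) _⟩
      rw [← Subtype.coe_lt_coe, ← hb, hk]
      exact h.section_lt k (by omega) _ _
  refine ⟨Set.range r, ⟨r, fun x => hfix _ (h.index_le x) _, rfl⟩, m, hm,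
    hrank.hasHeight (fun x => h.index_le _)
      ⟨⟨g m true, hR m le_rfl _⟩, h.index_section m le_rfl _⟩, fun k hk => ⟨le_rfl, ?_⟩, ?_⟩
  · have hval : ∀ b : Fin 2, (b : ℕ) ≤ 1 := by decide
    have hkb : ∀ b : Fin 2, k + (b : ℕ) ≤ m := fun b => by have := hval b; omega
    have hinj : ∀ i j : Fin 2, decide (i = 1) = decide (j = 1) → i = j := by decide
    refine isTwoRowed_of_injective
      (fun a => ⟨g (k + (a.2 : ℕ)) (decide (a.1 = 1)), hR _ (hkb _) _⟩) ?_ ?_ ?_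
    · rintro ⟨i, b⟩ ⟨j, d⟩ hab
      have hab := congrArg Subtype.val hab
      simp only at hab
      have h1 := congrArg s hab
      have h2 := congrArg κ hab
      rw [h.index_section _ (hkb _), h.index_section _ (hkb _)] at h1
      rw [h.colour_section _ (hkb _), h.colour_section _ (hkb _)] at h2
      exact Prod.ext (hinj _ _ h2) (Fin.ext (by simp only; omega))
    · intro x
      rw [hrank.mem_levelPair]
      obtain ⟨b, hb⟩ := hR' x
      constructor
      · rintro (hx | hx)
        · refine ⟨(cond b 1 0, 0), Subtype.ext ?_⟩
          rw [← hb, hx]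
          cases b <;> simp
        · refine ⟨(cond b 1 0, 1), Subtype.ext ?_⟩
          rw [← hb, hx]
          cases b <;> simp
      · rintro ⟨a, rfl⟩
        simp only [h.index_section _ (hkb _)]
        have := hval a.2
        omega
    · rintro ⟨i, b⟩ ⟨j, d⟩
      have hE : ∀ i j : Fin 2, i = j ∨ (i : ℕ) = ((j : ℕ) + 1) % 2 := by decide
      simp only [hE, and_true]
      have h3 := hval b
      have h4 := hval d
      constructor
      · intro hab
        have := hrank.lt_of_lt hab
        simp only [h.index_section _ (hkb _)] at this
        refine ⟨Fin.ext ?_, Fin.ext ?_⟩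
        · change (b : ℕ) = 0
          omega
        · change (d : ℕ) = 1
          omega
      · rintro ⟨rfl, rfl⟩
        exact h.section_lt k hk _ _
  · have key : ∀ (i j : ℕ) (hij : i < j) (hj : j ≤ m) (b d : Bool),
        Relation.TransGen (fun a b : Set.range r => a < b ∧
          ∃ k, a ∈ level (Set.range r) k ∧ b ∈ level (Set.range r) (k + 1))
          ⟨g i b, hR i (by omega) b⟩ ⟨g j d, hR j hj d⟩ := by
      have step : ∀ (i : ℕ) (hi : i < m) (b d : Bool), (fun a b : Set.range r => a < b ∧
          ∃ k, a ∈ level (Set.range r) k ∧ b ∈ level (Set.range r) (k + 1))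
          ⟨g i b, hR i (by omega) b⟩ ⟨g (i + 1) d, hR (i + 1) hi d⟩ := fun i hi b d =>
        ⟨h.section_lt i hi b d, i, (hrank.mem_level _ _).2 (h.index_section _ hi.le _),
          (hrank.mem_level _ _).2 (h.index_section _ hi _)⟩
      intro i j hij
      induction j, hij using Nat.le_induction with
      | base => exact fun hj b d => Relation.TransGen.single (step i hj b d)
      | succ j _ ih =>
        exact fun hj b d => (ih (by omega) b true).tail (step j hj true d)
    intro x y hxy
    have h1 := hrank.lt_of_lt hxy
    obtain ⟨b, hb⟩ := hR' x
    obtain ⟨d, hd⟩ := hR' y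
    have := key _ _ h1 (h.index_le _) b d
    simpa only [hb, hd] using this

end IsFold
-- The search on bit masks
/-- The layered order in terms of the indices `3 k + i` of the positions `(k, i)`. -/
def indexLT (w : ℕ → Bool) (x y : ℕ) : Bool :=
  bif Nat.ble (x / 3 + 2) (y / 3) then true else
  bif Nat.beq (x / 3 + 1) (y / 3) then
    (bif w (x / 3) then !(Nat.beq (x % 3) (y % 3)) else Nat.beq (x % 3) (y % 3))
  else false

/-- The binary number whose digits are the values of `p` below `n`. -/
def bitMask (p : ℕ → Bool) : ℕ → ℕ
  | 0 => 0
  | n + 1 => bif p n then Nat.lor (bitMask p n) (2 ^ n) else bitMask p n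

/-- `withValue v f` is `f v`; its kernel reduction evaluates `v` first. -/
def withValue {α : Type} (v : ℕ) (f : ℕ → α) : α :=
  Nat.rec (f 0) (fun n _ => f (Nat.succ n)) v

/-- A point as a singleton mask, with the masks of its strict lower and upper bounds. -/
abbrev MaskedPoint := ℕ × ℕ × ℕ

/-- The points `x, …, x + l - 1` of the relation `r` on the indices below `N`. -/
def maskedPoints (r : ℕ → ℕ → Bool) (N : ℕ) : ℕ → ℕ → List MaskedPoint
  | _, 0 => []
  | x, l + 1 =>
    withValue (2 ^ x) fun b => withValue (bitMask (fun y => r y x) N) fun d =>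
      withValue (bitMask (fun y => r x y) N) fun v =>
        (b, d, v) :: maskedPoints r N (x + 1) l

/-- The masks `a` and `b` are disjoint. -/
def disj (a b : ℕ) : Bool := Nat.beq (Nat.land a b) 0

/-- The maximal extensions of the disjoint, mutually incomparable sets `a`, `b` by points of the list
all of whose lower bounds lie in `D`, `a` or `b`, where the first point is always put into `a`. -/
def twoColourings (D : ℕ) : List MaskedPoint → ℕ → ℕ → List (ℕ × ℕ)
  | [], a, b => [(a, b)]
  | p :: t, a, b =>
    bif disj p.1 D && Nat.beq (Nat.land p.2.1 (Nat.lor D (Nat.lor a b))) p.2.1 then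
      bif disj p.2.1 b then
        -- Here `a` is open to the point. If no lower bound lies in `a` either, so is `b`, except
        -- for the first point: this removes the swap of colours.
        bif disj p.2.1 a && !(Nat.beq a 0) then
          withValue (Nat.lor a p.1) (fun a' => twoColourings D t a' b) ++
            withValue (Nat.lor b p.1) (fun b' => twoColourings D t a b')
        else withValue (Nat.lor a p.1) fun a' => twoColourings D t a' b
      else bif disj p.2.1 a then
        withValue (Nat.lor b p.1) fun b' => twoColourings D t a b'
      else twoColourings D t a b
    else twoColourings D t a b

/-- Insertion into a list of states sorted by the first component, omitting dominated states. -/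
def insertState (d u : ℕ) : List (ℕ × ℕ) → List (ℕ × ℕ)
  | [] => [(d, u)]
  | s :: t =>
    bif Nat.ble (d + 1) s.1 then (d, u) :: s :: t else
    bif Nat.beq d s.1 && Nat.beq (Nat.land u s.2) u then s :: t else
    s :: insertState d u t

/-- Insertion of the states `(E, v)`, where `v` consists of the common upper bounds of `p` and a
point of `b ∩ u` outside `E`. -/
def insertUppers (E u b : ℕ) (l : List MaskedPoint) (p : MaskedPoint)
    (acc : List (ℕ × ℕ)) : List (ℕ × ℕ) :=
  l.foldr (fun q acc => bif disj q.1 (Nat.land b u) then acc else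
      withValue (Nat.land p.2.2 q.2.2) fun v =>
        withValue (Nat.xor v (Nat.land v E)) fun v => insertState E v acc) acc

/-- Insertion of the successors of the state `(D, u)` for the next preimage `c.1 ∪ c.2`. -/
def insertNext (D u : ℕ) (l : List MaskedPoint) (c : ℕ × ℕ) (acc : List (ℕ × ℕ)) :
    List (ℕ × ℕ) :=
  bif disj c.1 u || disj c.2 u then acc else
  withValue (Nat.lor D (Nat.lor c.1 c.2)) fun E =>
    l.foldr (fun p acc => bif disj p.1 (Nat.land c.1 u) then acc else
      insertUppers E u c.2 l p acc) acc

/-- Search for a fold from a list of states `(D, u)`: `D` is the preimage of the first antichains,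
and the next antichain has to be contained in `u`. -/
def search (pts : List MaskedPoint) (full : ℕ) : ℕ → List (ℕ × ℕ) → Bool
  -- Exhausted fuel counts as success, so the bound chosen in `hasFold` cannot cause a false
  -- negative answer.
  | 0, _ => true
  | _ + 1, [] => false
  | f + 1, s :: t => bif Nat.beq s.1 full then true else
      search pts full f
        ((twoColourings s.1 pts 0 0).foldr
          (insertNext s.1 s.2 pts) t)

/-- Whether the layered poset of height `n` may have a fold. -/
def hasFold (w : ℕ → Bool) (n : ℕ) : Bool :=
  search (maskedPoints (indexLT w) (3 * (n + 1)) 0 (3 * (n + 1)))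
    (2 ^ (3 * (n + 1)) - 1) 200 [(0, 2 ^ (3 * (n + 1)) - 1)]

/-! ### Folds on indices and tightness -/

/-- A retraction onto an ordinal sum of two-element antichains, on the indices below `N`. -/
structure IsIndexFold (r : ℕ → ℕ → Bool) (N m : ℕ) (S : ℕ → ℕ) (K : ℕ → Bool)
    (G : ℕ → Bool → ℕ) : Prop where
  index_le : ∀ x < N, S x ≤ m
  section_lt_size : ∀ i ≤ m, ∀ b, G i b < N
  index_section : ∀ i ≤ m, ∀ b, S (G i b) = i
  colour_section : ∀ i ≤ m, ∀ b, K (G i b) = b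
  section_lt : ∀ i < m, ∀ b d, r (G i b) (G (i + 1) d) = true
  mono : ∀ x < N, ∀ y < N, r x y = true → S x < S y ∨ (S x = S y ∧ K x = K y)

/-- A fold such that no point can be moved to a lower antichain. -/
structure IsTightFold (r : ℕ → ℕ → Bool) (N m : ℕ) (S : ℕ → ℕ) (K : ℕ → Bool)
    (G : ℕ → Bool → ℕ) : Prop extends IsIndexFold r N m S K G where
  tight : ∀ x < N, ∀ i < S x, (∀ y < N, r y x = true → S y ≤ i) →
    ∀ b, ∃ y < N, r y x = true ∧ S y = i ∧ K y = b

/-- Moving points down as long as possible makes a fold tight. -/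
theorem IsIndexFold.exists_isTightFold {r : ℕ → ℕ → Bool} {N m : ℕ} {S : ℕ → ℕ} {K : ℕ → Bool}
    {G : ℕ → Bool → ℕ} (h : IsIndexFold r N m S K G) (hr : ∀ x y, r x y = true → x < y) :
    ∃ S K, IsTightFold r N m S K G := by
  obtain ⟨t, ht⟩ : ∃ t, ∑ x ∈ Finset.range N, S x = t := ⟨_, rfl⟩
  induction t using Nat.strong_induction_on generalizing S K with
  | _ t ih =>
    by_cases htight : ∀ x < N, ∀ i < S x, (∀ y < N, r y x = true → S y ≤ i) →
        ∀ b, ∃ y < N, r y x = true ∧ S y = i ∧ K y = b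
    · exact ⟨S, K, h, htight⟩
    push Not at htight
    obtain ⟨x, hx, i, hi, hlow, b, hb⟩ := htight
    -- Section points are never moved: both section points of antichain `j - 1` lie below `G j d`,
    -- so tightness cannot fail there.
    have hG : ∀ j ≤ m, ∀ d, G j d ≠ x := by
      rintro j hj d rfl
      rw [h.index_section j hj] at hi
      obtain ⟨k, rfl⟩ : ∃ k, j = k + 1 := ⟨j - 1, by omega⟩
      have hlt := h.section_lt k (by omega) b d
      have hk := h.section_lt_size k (by omega) b
      have h1 := hlow _ hk hlt
      rw [h.index_section k (by omega)] at h1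
      refine hb _ hk hlt ?_ (h.colour_section k (by omega) b)
      rw [h.index_section k (by omega)]
      omega
    -- No lower bound of `x` with index `i` has colour `b`, so `x` can take index `i` and colour
    -- `!b`; the sum of the indices drops.
    refine ih (∑ y ∈ Finset.range N, Function.update S x i y) ?_ (S := Function.update S x i)
      (K := Function.update K x !b) ?_ rfl
    · rw [← ht]
      refine Finset.sum_lt_sum (fun y _ => ?_) ⟨x, Finset.mem_range.2 hx, by simpa using hi⟩
      by_cases hy : y = x
      · subst hy
        simpa using hi.le
      · simp [hy]
    · refine ⟨fun y hy => ?_, h.section_lt_size, fun j hj d => ?_, fun j hj d => ?_,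
        h.section_lt, fun y hy z hz hyz => ?_⟩
      · by_cases hyx : y = x
        · subst hyx
          have := h.index_le y hy
          simp only [Function.update_self]
          omega
        · simpa [hyx] using h.index_le y hy
      · rw [Function.update_of_ne (hG j hj d), h.index_section j hj]
      · rw [Function.update_of_ne (hG j hj d), h.colour_section j hj]
      · have hmono := h.mono y hy z hz hyz
        have hne := (hr _ _ hyz).ne
        by_cases hyx : y = x
        · subst hyx
          rw [Function.update_self, Function.update_of_ne hne.symm]
          exact Or.inl (by omega)
        · rw [Function.update_of_ne hyx, Function.update_of_ne hyx]
          by_cases hzx : z = x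
          · subst hzx
            rw [Function.update_self, Function.update_self]
            rcases (hlow y hy hyz).lt_or_eq with h1 | h1
            · exact Or.inl h1
            · refine Or.inr ⟨h1, ?_⟩
              have := hb y hy hyz h1
              cases b <;> simpa using this
          · rwa [Function.update_of_ne hzx, Function.update_of_ne hzx]

/-! ### Bit masks and insertion of states -/

theorem testBit_bitMask (p : ℕ → Bool) (n x : ℕ) :
    (bitMask p n).testBit x = true ↔ x < n ∧ p x = true := by
  induction n with
  | zero => simp [bitMask]
  | succ n ih =>
    rw [bitMask]
    cases hp : p n
    · rw [cond_false, ih, Nat.lt_succ_iff_lt_or_eq]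
      constructor
      · exact fun h => ⟨Or.inl h.1, h.2⟩
      · rintro ⟨h | rfl, h'⟩
        · exact ⟨h, h'⟩
        · rw [hp] at h'
          cases h'
    · rw [cond_true]
      change (bitMask p n ||| 2 ^ n).testBit x = true ↔ _
      rw [Nat.testBit_or, Bool.or_eq_true, ih, Nat.testBit_two_pow, decide_eq_true_iff,
        Nat.lt_succ_iff_lt_or_eq]
      constructor
      · rintro (h | rfl)
        · exact ⟨Or.inl h.1, h.2⟩
        · exact ⟨Or.inr rfl, hp⟩
      · rintro ⟨h | rfl, h'⟩
        · exact Or.inl ⟨h, h'⟩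
        · exact Or.inr rfl

theorem withValue_eq {α : Type} (v : ℕ) (f : ℕ → α) : withValue v f = f v := by
  cases v <;> rfl

theorem testBit_lor (a b x : ℕ) :
    (Nat.lor a b).testBit x = true ↔ a.testBit x = true ∨ b.testBit x = true := by
  change (a ||| b).testBit x = true ↔ _
  rw [Nat.testBit_or, Bool.or_eq_true]

theorem testBit_land (a b x : ℕ) :
    (Nat.land a b).testBit x = true ↔ a.testBit x = true ∧ b.testBit x = true := by
  change (a &&& b).testBit x = true ↔ _
  rw [Nat.testBit_and, Bool.and_eq_true]

theorem disj_iff (a b : ℕ) :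
    disj a b = true ↔ ∀ x, a.testBit x = true → ¬ b.testBit x = true := by
  rw [disj, Nat.beq_eq]
  constructor
  · intro h x ha hb
    have := (testBit_land a b x).2 ⟨ha, hb⟩
    rw [h, Nat.zero_testBit] at this
    cases this
  · intro h
    refine Nat.eq_of_testBit_eq fun x => ?_
    rw [Nat.zero_testBit, Bool.eq_false_iff]
    exact fun hx => h x ((testBit_land a b x).1 hx).1 ((testBit_land a b x).1 hx).2

theorem disj_two_pow_iff (x b : ℕ) : disj (2 ^ x) b = true ↔ ¬ b.testBit x = true := by
  rw [disj_iff]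
  simp [Nat.testBit_two_pow]

theorem land_eq_left_iff (a b : ℕ) :
    Nat.beq (Nat.land a b) a = true ↔ ∀ x, a.testBit x = true → b.testBit x = true := by
  rw [Nat.beq_eq]
  constructor
  · intro h x ha
    rw [← h] at ha
    exact ((testBit_land a b x).1 ha).2
  · intro h
    refine Nat.eq_of_testBit_eq fun x => ?_
    rw [Bool.eq_iff_iff, testBit_land]
    exact ⟨fun h => h.1, fun ha => ⟨ha, h x ha⟩⟩

/-- The point `x` of the relation `r` on the indices below `N`. -/
def maskedPoint (r : ℕ → ℕ → Bool) (N x : ℕ) : MaskedPoint :=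
  (2 ^ x, bitMask (fun y => r y x) N, bitMask (fun y => r x y) N)

theorem maskedPoints_eq (r : ℕ → ℕ → Bool) (N x l : ℕ) :
    maskedPoints r N x l = (List.range' x l).map (maskedPoint r N) := by
  induction l generalizing x with
  | zero => rfl
  | succ l ih => simp only [maskedPoints, withValue_eq, ih, List.range'_succ, List.map_cons,
      maskedPoint]

theorem mem_insertState_of_mem (d u : ℕ) {s : ℕ × ℕ} {l : List (ℕ × ℕ)} (h : s ∈ l) :
    s ∈ insertState d u l := by
  induction l with
  | nil => cases h
  | cons t l ih =>
    rw [insertState, Bool.cond_eq_ite, Bool.cond_eq_ite]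
    split
    · exact List.mem_cons_of_mem _ h
    · split
      · exact h
      · rcases List.mem_cons.1 h with rfl | h
        · exact List.mem_cons_self
        · exact List.mem_cons_of_mem _ (ih h)

/-- A state is omitted only in favour of one with the same first and a larger second component,
which is why the inserted state is recovered only up to inclusion. -/
theorem exists_mem_insertState (d u : ℕ) (l : List (ℕ × ℕ)) :
    ∃ v, (d, v) ∈ insertState d u l ∧ ∀ x, u.testBit x = true → v.testBit x = true := by
  induction l with
  | nil => exact ⟨u, by simp [insertState], fun _ h => h⟩
  | cons t l ih =>
    rw [insertState, Bool.cond_eq_ite, Bool.cond_eq_ite]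
    split
    · exact ⟨u, List.mem_cons_self, fun _ h => h⟩
    · split
      · rename_i h
        rw [Bool.and_eq_true, land_eq_left_iff, Nat.beq_eq] at h
        exact ⟨t.2, by rw [h.1]; exact List.mem_cons_self, h.2⟩
      · obtain ⟨v, hv, h⟩ := ih
        exact ⟨v, List.mem_cons_of_mem _ hv, h⟩

theorem subset_foldr {α β : Type} (F : α → List β → List β) (hF : ∀ a acc, acc ⊆ F a acc)
    (l : List α) (acc : List β) : acc ⊆ l.foldr F acc := by
  induction l with
  | nil => exact List.Subset.refl _
  | cons a l ih => exact List.Subset.trans ih (hF _ _)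

theorem exists_subset_foldr {α β : Type} (F : α → List β → List β)
    (hF : ∀ a acc, acc ⊆ F a acc) {l : List α} {a : α} (ha : a ∈ l) (acc : List β) :
    ∃ acc', F a acc' ⊆ l.foldr F acc := by
  induction l with
  | nil => cases ha
  | cons b l ih =>
    rcases List.mem_cons.1 ha with rfl | ha
    · exact ⟨l.foldr F acc, List.Subset.refl _⟩
    · obtain ⟨acc', h⟩ := ih ha
      exact ⟨acc', List.Subset.trans h (hF _ _)⟩

theorem subset_insertUppers_step (E u b : ℕ) (p q : MaskedPoint) (acc : List (ℕ × ℕ)) :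
    acc ⊆ bif disj q.1 (Nat.land b u) then acc else
      withValue (Nat.land p.2.2 q.2.2) fun v =>
        withValue (Nat.xor v (Nat.land v E)) fun v => insertState E v acc := by
  rw [Bool.cond_eq_ite, withValue_eq, withValue_eq]
  split
  · exact List.Subset.refl _
  · exact fun s hs => mem_insertState_of_mem _ _ hs

theorem subset_insertNext_step (E u : ℕ) (c : ℕ × ℕ) (l : List MaskedPoint) (p : MaskedPoint)
    (acc : List (ℕ × ℕ)) :
    acc ⊆ bif disj p.1 (Nat.land c.1 u) then acc else insertUppers E u c.2 l p acc := by
  rw [Bool.cond_eq_ite]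
  split
  · exact List.Subset.refl _
  · exact subset_foldr _ (subset_insertUppers_step E u c.2 p) l acc

theorem subset_insertNext (D u : ℕ) (l : List MaskedPoint) (c : ℕ × ℕ) (acc : List (ℕ × ℕ)) :
    acc ⊆ insertNext D u l c acc := by
  rw [insertNext, Bool.cond_eq_ite, withValue_eq]
  split
  · exact List.Subset.refl _
  · exact subset_foldr _ (subset_insertNext_step _ u c l) l acc

/-- A pair of points of different colours contributes their common upper bounds. -/
theorem exists_mem_insertNext {D u : ℕ} {l : List MaskedPoint} {c : ℕ × ℕ}
    {p q : MaskedPoint} (hp : p ∈ l) (hq : q ∈ l) (hpc : disj p.1 (Nat.land c.1 u) = false)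
    (hqc : disj q.1 (Nat.land c.2 u) = false) (hc : disj c.1 u = false) (hc' : disj c.2 u = false)
    (acc : List (ℕ × ℕ)) :
    ∃ v, (Nat.lor D (Nat.lor c.1 c.2), v) ∈ insertNext D u l c acc ∧
      ∀ x, p.2.2.testBit x = true → q.2.2.testBit x = true →
        ¬ (Nat.lor D (Nat.lor c.1 c.2)).testBit x = true → v.testBit x = true := by
  rw [insertNext, hc, hc', Bool.or_false, cond_false, withValue_eq]
  generalize Nat.lor D (Nat.lor c.1 c.2) = E
  obtain ⟨acc₁, h₁⟩ := exists_subset_foldr _ (subset_insertNext_step E u c l) hp acc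
  rw [hpc, cond_false] at h₁
  obtain ⟨acc₂, h₂⟩ := exists_subset_foldr _ (subset_insertUppers_step E u c.2 p) hq acc₁
  rw [hqc, cond_false, withValue_eq, withValue_eq] at h₂
  obtain ⟨v, hv, h⟩ := exists_mem_insertState E
    (Nat.xor (Nat.land p.2.2 q.2.2) (Nat.land (Nat.land p.2.2 q.2.2) E)) acc₂
  refine ⟨v, h₁ (h₂ hv), fun x hpx hqx hE => h x ?_⟩
  change ((p.2.2 &&& q.2.2) ^^^ ((p.2.2 &&& q.2.2) &&& E)).testBit x = true
  rw [Bool.not_eq_true] at hE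
  simp [Nat.testBit_xor, Nat.testBit_and, hpx, hqx, hE]

/-! ### Soundness of the search -/

namespace IsTightFold

variable {r : ℕ → ℕ → Bool} {N m : ℕ} {S : ℕ → ℕ} {K : ℕ → Bool} {G : ℕ → Bool → ℕ}

/-- Points are visited in a linear extension, so all lower bounds of a point are decided before it.
Following the branch dictated by `S` and `K` keeps `a` and `b` equal to the visited points of index
`i` with colour `c` and the other colour. Leaving out an admissible point is not a branch; tightness
shows that it is not needed. -/
theorem exists_mem_twoColourings (h : IsTightFold r N m S K G)
    (hr : ∀ x y, r x y = true → x < y) {i D : ℕ} {c : Bool}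
    (hD : ∀ x, D.testBit x = true ↔ x < N ∧ S x < i)
    (hc : ∀ x < N, S x = i → K x ≠ c → ∃ z < x, S z = i ∧ K z = c)
    (l x a b : ℕ) (hx : x + l = N)
    (ha : ∀ y, a.testBit y = true ↔ y < x ∧ S y = i ∧ K y = c)
    (hb : ∀ y, b.testBit y = true ↔ y < x ∧ S y = i ∧ K y ≠ c) :
    ∃ p ∈ twoColourings D ((List.range' x l).map (maskedPoint r N)) a b,
      (∀ y, p.1.testBit y = true ↔ y < N ∧ S y = i ∧ K y = c) ∧
      ∀ y, p.2.testBit y = true ↔ y < N ∧ S y = i ∧ K y ≠ c := by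
  induction l generalizing x a b with
  | zero =>
    obtain rfl : x = N := hx
    exact ⟨(a, b), by simp [twoColourings], ha, hb⟩
  | succ l ih =>
    have hxN : x < N := by omega
    have hlow : ∀ y, (bitMask (fun y => r y x) N).testBit y = true ↔ y < N ∧ r y x = true :=
      fun y => testBit_bitMask _ _ _
    have hlt : ∀ y, y < x + 1 ↔ y < x ∨ y = x := fun y => Nat.lt_succ_iff_lt_or_eq
    rw [List.range'_succ, List.map_cons, twoColourings]
    simp only [maskedPoint, withValue_eq, Bool.cond_eq_ite]
    have skip : S x ≠ i →
        ∃ p ∈ twoColourings D ((List.range' (x + 1) l).map (maskedPoint r N)) a b,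
          (∀ y, p.1.testBit y = true ↔ y < N ∧ S y = i ∧ K y = c) ∧
          ∀ y, p.2.testBit y = true ↔ y < N ∧ S y = i ∧ K y ≠ c := by
      intro hxi
      refine ih (x + 1) a b (by omega) (fun y => ?_) fun y => ?_
      · rw [ha, hlt]
        refine ⟨fun hy => ⟨Or.inl hy.1, hy.2⟩, ?_⟩
        rintro ⟨hy | rfl, hy'⟩
        · exact ⟨hy, hy'⟩
        · exact absurd hy'.1 hxi
      · rw [hb, hlt]
        refine ⟨fun hy => ⟨Or.inl hy.1, hy.2⟩, ?_⟩
        rintro ⟨hy | rfl, hy'⟩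
        · exact ⟨hy, hy'⟩
        · exact absurd hy'.1 hxi
    have left : S x = i → K x = c →
        ∃ p ∈ twoColourings D ((List.range' (x + 1) l).map (maskedPoint r N))
          (Nat.lor a (2 ^ x)) b,
          (∀ y, p.1.testBit y = true ↔ y < N ∧ S y = i ∧ K y = c) ∧
          ∀ y, p.2.testBit y = true ↔ y < N ∧ S y = i ∧ K y ≠ c := by
      intro hxi hxc
      refine ih (x + 1) _ b (by omega) (fun y => ?_) fun y => ?_
      · rw [testBit_lor, ha, hlt, Nat.testBit_two_pow, decide_eq_true_iff]
        constructor
        · rintro (hy | rfl)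
          · exact ⟨Or.inl hy.1, hy.2⟩
          · exact ⟨Or.inr rfl, hxi, hxc⟩
        · rintro ⟨hy | rfl, hy'⟩
          · exact Or.inl ⟨hy, hy'⟩
          · exact Or.inr rfl
      · rw [hb, hlt]
        refine ⟨fun hy => ⟨Or.inl hy.1, hy.2⟩, ?_⟩
        rintro ⟨hy | rfl, hy'⟩
        · exact ⟨hy, hy'⟩
        · exact absurd hxc hy'.2
    have right : S x = i → K x ≠ c →
        ∃ p ∈ twoColourings D ((List.range' (x + 1) l).map (maskedPoint r N)) a
          (Nat.lor b (2 ^ x)),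
          (∀ y, p.1.testBit y = true ↔ y < N ∧ S y = i ∧ K y = c) ∧
          ∀ y, p.2.testBit y = true ↔ y < N ∧ S y = i ∧ K y ≠ c := by
      intro hxi hxc
      refine ih (x + 1) a _ (by omega) (fun y => ?_) fun y => ?_
      · rw [ha, hlt]
        refine ⟨fun hy => ⟨Or.inl hy.1, hy.2⟩, ?_⟩
        rintro ⟨hy | rfl, hy'⟩
        · exact ⟨hy, hy'⟩
        · exact absurd hy'.2 hxc
      · rw [testBit_lor, hb, hlt, Nat.testBit_two_pow, decide_eq_true_iff]
        constructor
        · rintro (hy | rfl)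
          · exact ⟨Or.inl hy.1, hy.2⟩
          · exact ⟨Or.inr rfl, hxi, hxc⟩
        · rintro ⟨hy | rfl, hy'⟩
          · exact Or.inl ⟨hy, hy'⟩
          · exact Or.inr rfl
    rcases lt_trichotomy (S x) i with hxi | hxi | hxi
    · rw [if_neg]
      · exact skip hxi.ne
      · rw [Bool.and_eq_true, disj_two_pow_iff]
        exact fun hcon => hcon.1 ((hD x).2 ⟨hxN, hxi⟩)
    · have hmono : ∀ y, y < N → r y x = true → S y < i ∨ (S y = i ∧ K y = K x) :=
        fun y hy hyx => hxi ▸ h.mono y hy x hxN hyx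
      rw [if_pos]
      · by_cases hxc : K x = c
        · have hdisj : disj (bitMask (fun y => r y x) N) b = true := by
            rw [disj_iff]
            intro y hy hyb
            rw [hlow] at hy
            rw [hb] at hyb
            rcases hmono y hy.1 hy.2 with h1 | h1
            · omega
            · exact hyb.2.2 (h1.2.trans hxc)
          rw [if_pos hdisj]
          obtain ⟨p, hp, hp'⟩ := left hxi hxc
          split
          · exact ⟨p, List.mem_append_left _ hp, hp'⟩
          · exact ⟨p, hp, hp'⟩
        · have hdisj : disj (bitMask (fun y => r y x) N) a = true := by
            rw [disj_iff]
            intro y hy hya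
            rw [hlow] at hy
            rw [ha] at hya
            rcases hmono y hy.1 hy.2 with h1 | h1
            · omega
            · exact hxc (h1.2.symm.trans hya.2.2)
          -- By `hc` an earlier point of index `i` has colour `c`, so `a` is nonempty and the branch
          -- for `b` is available.
          have ha0 : Nat.beq a 0 = false := by
            rw [Bool.eq_false_iff]
            intro hcon
            rw [Nat.beq_eq] at hcon
            obtain ⟨z, hz, hz'⟩ := hc x hxN hxi hxc
            have := (ha z).2 ⟨hz, hz'⟩
            rw [hcon, Nat.zero_testBit] at this
            cases this
          obtain ⟨p, hp, hp'⟩ := right hxi hxc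
          simp only [hdisj, ha0, Bool.not_false, Bool.and_true, if_true]
          split
          · exact ⟨p, List.mem_append_right _ hp, hp'⟩
          · exact ⟨p, hp, hp'⟩
      · rw [Bool.and_eq_true, disj_two_pow_iff, land_eq_left_iff]
        refine ⟨fun hcon => ?_, fun y hy => ?_⟩
        · have := ((hD x).1 hcon).2
          omega
        · rw [hlow] at hy
          rw [testBit_lor, testBit_lor, hD, ha, hb]
          have hyx := hr _ _ hy.2
          rcases hmono y hy.1 hy.2 with h1 | h1
          · exact Or.inl ⟨hy.1, h1⟩
          · by_cases hyc : K y = c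
            · exact Or.inr (Or.inl ⟨hyx, h1.1, hyc⟩)
            · exact Or.inr (Or.inr ⟨hyx, h1.1, hyc⟩)
    · split
      · rename_i hcond
        rw [Bool.and_eq_true, land_eq_left_iff] at hcond
        -- All lower bounds have index at most `i`. Tightness yields lower bounds of index `i` in
        -- both colours, so both disjointness tests fail and the point is left for a later
        -- antichain.
        have htight := h.tight x hxN i hxi fun y hy hyx => by
          have := hcond.2 y ((hlow y).2 ⟨hy, hyx⟩)
          rw [testBit_lor, testBit_lor, hD, ha, hb] at this
          omega
        rw [if_neg, if_neg]
        · exact skip hxi.ne'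
        · rw [disj_iff]
          intro hcon
          obtain ⟨y, hy, hyx, hyi, hyc⟩ := htight c
          exact hcon y ((hlow y).2 ⟨hy, hyx⟩) ((ha y).2 ⟨hr _ _ hyx, hyi, hyc⟩)
        · rw [disj_iff]
          intro hcon
          obtain ⟨y, hy, hyx, hyi, hyc⟩ := htight (!c)
          exact hcon y ((hlow y).2 ⟨hy, hyx⟩)
            ((hb y).2 ⟨hr _ _ hyx, hyi, by rw [hyc]; cases c <;> decide⟩)
      · exact skip hxi.ne'

/-- The search state `(D, u)` describes the first `i` antichains: `D` is their preimage, and `u`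
contains the next antichain. -/
def Describes (N m : ℕ) (S : ℕ → ℕ) (G : ℕ → Bool → ℕ) (i : ℕ) (s : ℕ × ℕ) : Prop :=
  (∀ x, s.1.testBit x = true ↔ x < N ∧ S x < i) ∧ (i ≤ m → ∀ b, s.2.testBit (G i b) = true)

/-- The antichain `i + 1` consists of common upper bounds of the two section points of antichain
`i`, outside the preimages found so far. This is all that the next state has to know about the
chosen section. -/
theorem exists_describes_succ (h : IsTightFold r N m S K G)
    (hr : ∀ x y, r x y = true → x < y) {i : ℕ} (hi : i ≤ m) {s : ℕ × ℕ}
    (hs : Describes N m S G i s) (acc : List (ℕ × ℕ)) :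
    ∃ t ∈ (twoColourings s.1 (maskedPoints r N 0 N) 0 0).foldr
      (insertNext s.1 s.2 (maskedPoints r N 0 N)) acc, Describes N m S G (i + 1) t := by
  classical
  obtain ⟨D, u⟩ := s
  obtain ⟨hD, hu⟩ := hs
  have hu := hu hi
  simp only at hD hu ⊢
  have hex : ∃ x, S x = i := ⟨_, h.index_section i hi true⟩
  -- The colour of the first point of index `i` is assigned to the class `a`, as the convention of
  -- `twoColourings` requires.
  obtain ⟨c, hc⟩ : ∃ c, K (Nat.find hex) = c := ⟨_, rfl⟩
  rw [maskedPoints_eq]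
  obtain ⟨p, hp, hp1, hp2⟩ := h.exists_mem_twoColourings hr (c := c) hD
    (fun x _ hxi hxc => by
      rcases (Nat.find_min' hex hxi).eq_or_lt with he | hlt
      · exact absurd (he ▸ hc) hxc
      · exact ⟨_, hlt, Nat.find_spec hex, hc⟩) N 0 0 0 (by omega) (by simp) (by simp)
  have hG : ∀ b, G i b < N ∧ S (G i b) = i ∧ K (G i b) = b := fun b =>
    ⟨h.section_lt_size i hi b, h.index_section i hi b, h.colour_section i hi b⟩
  have hmem : ∀ b, maskedPoint r N (G i b) ∈ (List.range' 0 N).map (maskedPoint r N) := fun b =>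
    List.mem_map_of_mem (by simp [(hG b).1])
  have hb1 : p.1.testBit (G i c) = true := (hp1 _).2 (hG c)
  have hb2 : p.2.testBit (G i !c) = true :=
    (hp2 _).2 ⟨(hG _).1, (hG _).2.1, by rw [(hG _).2.2]; cases c <;> decide⟩
  have hdisj : ∀ a x, a.testBit x = true → u.testBit x = true → disj a u = false := by
    intro a x ha hx
    rw [Bool.eq_false_iff, ne_eq, disj_iff]
    exact fun hcon => hcon x ha hx
  have hdisj' : ∀ a x, a.testBit x = true → u.testBit x = true →
      disj (2 ^ x) (Nat.land a u) = false := by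
    intro a x ha hx
    rw [Bool.eq_false_iff, ne_eq, disj_two_pow_iff, not_not, testBit_land]
    exact ⟨ha, hx⟩
  obtain ⟨acc', hacc⟩ := exists_subset_foldr _
    (subset_insertNext D u ((List.range' 0 N).map (maskedPoint r N))) hp acc
  obtain ⟨v, hv, hv'⟩ := exists_mem_insertNext (D := D) (hmem c) (hmem !c)
    (hdisj' _ _ hb1 (hu c)) (hdisj' _ _ hb2 (hu _)) (hdisj _ _ hb1 (hu c))
    (hdisj _ _ hb2 (hu _)) acc'
  have hE : ∀ x, (Nat.lor D (Nat.lor p.1 p.2)).testBit x = true ↔ x < N ∧ S x < i + 1 := by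
    intro x
    rw [testBit_lor, testBit_lor, hD, hp1, hp2, Nat.lt_succ_iff_lt_or_eq]
    tauto
  refine ⟨_, hacc hv, hE, fun hi' b => hv' _ ?_ ?_ ?_⟩
  · exact (testBit_bitMask _ _ _).2 ⟨h.section_lt_size _ hi' _, h.section_lt _ hi' _ _⟩
  · exact (testBit_bitMask _ _ _).2 ⟨h.section_lt_size _ hi' _, h.section_lt _ hi' _ _⟩
  · rw [hE, h.index_section _ hi']
    omega

/-- The list always contains a state describing an initial part of the given fold: when it is taken
out, a successor replaces it. After all `m + 1` antichains its first component is full. -/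
theorem search_eq_true (h : IsTightFold r N m S K G) (hr : ∀ x y, r x y = true → x < y)
    (f : ℕ) (l : List (ℕ × ℕ)) (hl : ∃ i ≤ m + 1, ∃ s ∈ l, Describes N m S G i s) :
    search (maskedPoints r N 0 N) (2 ^ N - 1) f l = true := by
  induction f generalizing l with
  | zero => rfl
  | succ f ih =>
    obtain ⟨i, hi, s, hs, hd⟩ := hl
    cases l with
    | nil => cases hs
    | cons t l =>
      rw [search, Bool.cond_eq_ite]
      split
      · rfl
      · rename_i hfull
        apply ih
        rcases List.mem_cons.1 hs with rfl | hs
        · have him : i ≤ m := by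
            by_contra hcon
            obtain rfl : i = m + 1 := by omega
            apply hfull
            rw [Nat.beq_eq]
            refine Nat.eq_of_testBit_eq fun x => ?_
            rw [Bool.eq_iff_iff, hd.1, Nat.testBit_two_pow_sub_one, decide_eq_true_iff]
            exact ⟨fun hx => hx.1, fun hx => ⟨hx, Nat.lt_succ_of_le (h.index_le x hx)⟩⟩
          obtain ⟨t, ht, hdt⟩ := h.exists_describes_succ hr him hd l
          exact ⟨i + 1, by omega, t, ht, hdt⟩
        · refine ⟨i, hi, s, ?_, hd⟩
          exact subset_foldr _ (subset_insertNext t.1 t.2 (maskedPoints r N 0 N)) _ _ hs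

end IsTightFold
-- Transfer between layered posets and indices
/-- The word of a code. -/
def wordOf (c : List (Fin 2)) (k : ℕ) : Bool := Nat.beq (c.getD k 0) 1

/-- The position with index `x`. -/
def positionOf (x : ℕ) : ℕ × Fin 3 := (x / 3, ⟨x % 3, Nat.mod_lt _ (by decide)⟩)

/-- The index of a position. -/
def indexOf (a : ℕ × Fin 3) : ℕ := 3 * a.1 + a.2

theorem positionOf_indexOf (a : ℕ × Fin 3) : positionOf (indexOf a) = a := by
  have := a.2.2
  refine Prod.ext ?_ (Fin.ext ?_) <;> simp only [positionOf, indexOf] <;> omega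

theorem indexOf_lt {a : ℕ × Fin 3} {n : ℕ} (h : a.1 ≤ n) : indexOf a < 3 * (n + 1) := by
  have := a.2.2
  simp only [indexOf]
  omega

theorem indexLT_iff (w : ℕ → Bool) (x y : ℕ) :
    indexLT w x y = true ↔ LayerLT w (positionOf x) (positionOf y) := by
  unfold indexLT LayerLT positionOf
  simp only [Fin.mk.injEq, ne_eq]
  have hble : (Nat.ble (x / 3 + 2) (y / 3) = true) ↔ x / 3 + 2 ≤ y / 3 := by rw [Nat.ble_eq]
  have hbeq : (Nat.beq (x / 3 + 1) (y / 3) = true) ↔ x / 3 + 1 = y / 3 := by rw [Nat.beq_eq]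
  have hmod : (Nat.beq (x % 3) (y % 3) = true) ↔ x % 3 = y % 3 := by rw [Nat.beq_eq]
  cases h1 : Nat.ble (x / 3 + 2) (y / 3)
  · rw [← hble, ← hbeq, h1]
    cases h2 : Nat.beq (x / 3 + 1) (y / 3)
    · simp
    · rw [← hmod]
      cases w (x / 3) <;> cases Nat.beq (x % 3) (y % 3) <;> simp
  · exact iff_of_true rfl (Or.inl (hble.1 h1))

theorem lt_of_indexLT (w : ℕ → Bool) (x y : ℕ) (h : indexLT w x y = true) : x < y := by
  have := ((indexLT_iff w x y).1 h).fst_lt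
  simp only [positionOf] at this
  omega

/-- A fold of the layered poset of height `n` given by the list `F` of the numbers
`2 * index + colour` of all points and the list `G` of the points of its antichains. -/
def checkFold (w : ℕ → Bool) (n m : ℕ) (F G : List ℕ) : Bool :=
  ((List.range (3 * (n + 1))).all fun x => Nat.ble (F.getD x 0 / 2) m &&
    (List.range (3 * (n + 1))).all fun y => bif indexLT w x y then
      Nat.ble (F.getD x 0 / 2 + 1) (F.getD y 0 / 2) || Nat.beq (F.getD x 0) (F.getD y 0)
      else true) &&
  ((List.range (2 * (m + 1))).all fun j => Nat.ble (G.getD j 0 + 1) (3 * (n + 1)) &&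
    Nat.beq (F.getD (G.getD j 0) 0) j) &&
  (List.range m).all fun i => (List.range 2).all fun b => (List.range 2).all fun d =>
    indexLT w (G.getD (2 * i + b) 0) (G.getD (2 * (i + 1) + d) 0)

namespace IsLayering

variable {P : Type u} [PartialOrder P] {n : ℕ} {w : ℕ → Bool} {pos : P → ℕ × Fin 3}

theorem exists_pointOf (h : IsLayering n w pos) :
    ∃ e : ℕ → P, (∀ x < 3 * (n + 1), pos (e x) = positionOf x) ∧
      (∀ p, e (indexOf (pos p)) = p) ∧
      ∀ x < 3 * (n + 1), ∀ y < 3 * (n + 1), e x < e y ↔ indexLT w x y = true := by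
  obtain ⟨p, -⟩ := h.exists_eq (0, 0) (Nat.zero_le _)
  have : Nonempty P := ⟨p⟩
  have hex : ∀ x < 3 * (n + 1), ∃ p, pos p = positionOf x := fun x hx =>
    h.exists_eq _ (by simp only [positionOf]; omega)
  choose! e he using hex
  refine ⟨e, he, fun p => h.injective ?_, fun x hx y hy => ?_⟩
  · rw [he _ (indexOf_lt (h.fst_le p)), positionOf_indexOf]
  · rw [h.lt_iff, he x hx, he y hy, indexLT_iff]

/-- The search succeeds on the words of layered posets with a 4-crown stack as retract. -/
theorem hasFold_eq_true (h : IsLayering n w pos) (hP : HasFourCrownStackRetract P) :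
    hasFold w n = true := by
  obtain ⟨m, s, κ, g, -, hg⟩ := hP.exists_isFold
  obtain ⟨e, -, hei, hlt⟩ := h.exists_pointOf
  have hsize : ∀ p, indexOf (pos p) < 3 * (n + 1) := fun p => indexOf_lt (h.fst_le p)
  have hfold : IsIndexFold (indexLT w) (3 * (n + 1)) m (fun x => s (e x)) (fun x => κ (e x))
      (fun i b => indexOf (pos (g i b))) := by
    refine ⟨fun x _ => hg.index_le _, fun i _ b => hsize _, fun i hi b => ?_, fun i hi b => ?_,
      fun i hi b d => ?_, fun x hx y hy hxy => hg.mono _ _ ((hlt x hx y hy).2 hxy)⟩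
    · simp only [hei, hg.index_section i hi]
    · simp only [hei, hg.colour_section i hi]
    · rw [← hlt _ (hsize _) _ (hsize _), hei, hei]
      exact hg.section_lt i hi b d
  obtain ⟨S, K, htight⟩ := hfold.exists_isTightFold (lt_of_indexLT w)
  refine htight.search_eq_true (lt_of_indexLT w) _ _ ⟨0, by omega, _, List.mem_singleton_self _,
    fun x => by simp, fun _ b => ?_⟩
  rw [Nat.testBit_two_pow_sub_one, decide_eq_true_iff]
  exact htight.section_lt_size 0 (Nat.zero_le _) b

theorem hasFourCrownStackRetract (h : IsLayering n w pos) {m : ℕ} (hm : 1 ≤ m) {F G : List ℕ}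
    (hc : checkFold w n m F G = true) : HasFourCrownStackRetract P := by
  obtain ⟨e, hpos, hei, hlt⟩ := h.exists_pointOf
  have hsize : ∀ p, indexOf (pos p) < 3 * (n + 1) := fun p => indexOf_lt (h.fst_le p)
  have hei' : ∀ x < 3 * (n + 1), indexOf (pos (e x)) = x := fun x hx => by
    rw [hpos x hx]
    simp only [positionOf, indexOf]
    omega
  simp only [checkFold, Bool.and_eq_true, List.all_eq_true, List.mem_range, Nat.ble_eq,
    Nat.beq_eq, Bool.cond_eq_ite] at hc
  obtain ⟨⟨h1, h2⟩, h3⟩ := hc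
  have hval : ∀ b : Bool, b.toNat ≤ 1 := by decide
  -- Entry `2 * i + b` of `G` is the point of antichain `i` with colour `b`, and its value in `F` is
  -- the same number.
  have hG : ∀ i ≤ m, ∀ b : Bool, G.getD (2 * i + b.toNat) 0 < 3 * (n + 1) ∧
      F.getD (G.getD (2 * i + b.toNat) 0) 0 = 2 * i + b.toNat := fun i hi b =>
    h2 _ (by have := hval b; omega)
  refine IsFold.hasFourCrownStackRetract (m := m) (s := fun p => F.getD (indexOf (pos p)) 0 / 2)
    (κ := fun p => Nat.beq (F.getD (indexOf (pos p)) 0 % 2) 1)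
    (g := fun i b => e (G.getD (2 * i + b.toNat) 0))
    ⟨fun p => (h1 _ (hsize p)).1, fun i hi b => ?_, fun i hi b => ?_, fun i hi b d => ?_,
      fun p q hpq => ?_⟩ hm
  · simp only [hei' _ (hG i hi b).1, (hG i hi b).2]
    have := hval b
    omega
  · simp only [hei' _ (hG i hi b).1, (hG i hi b).2, Nat.mul_add_mod]
    cases b <;> rfl
  · rw [hlt _ (hG i hi.le b).1 _ (hG (i + 1) hi d).1]
    exact h3 i hi _ (Nat.lt_succ_of_le (hval b)) _ (Nat.lt_succ_of_le (hval d))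
  · rw [← hei p, ← hei q, hlt _ (hsize p) _ (hsize q)] at hpq
    have := (h1 _ (hsize p)).2 _ (hsize q)
    rw [if_pos hpq, Bool.or_eq_true, Nat.ble_eq, Nat.beq_eq] at this
    rcases this with this | this
    · exact Or.inl this
    · simp only [this]
      exact Or.inr ⟨trivial, trivial⟩

end IsLayering

/-! ### Certificates and evaluation of the table -/

/-- Retractions onto 4-crown stacks for the codes marked `y`. -/
def foldCertificates : List (List (Fin 2) × List ℕ × List ℕ) :=
  [
   ([1,0], [0, 0, 1, 2, 2, 0, 2, 2, 3],
    [0, 2, 4, 8]),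
   ([1,1,1], [0, 0, 1, 2, 3, 0, 3, 2, 4, 4, 4, 5],
    [0, 2, 7, 4, 9, 11]),
   ([1,0,1], [0, 0, 1, 2, 2, 0, 2, 2, 3, 4, 5, 2],
    [0, 2, 4, 8, 9, 10]),
   ([1,0,0,1], [0, 0, 1, 2, 2, 0, 2, 2, 3, 2, 2, 4, 4, 4, 5],
    [0, 2, 4, 8, 11, 14]),
   ([1,0,1,0], [0, 0, 1, 2, 2, 0, 2, 2, 3, 4, 4, 2, 4, 4, 5],
    [0, 2, 4, 8, 9, 14]),
   ([1,0,0,0], [0, 0, 1, 2, 2, 0, 2, 2, 3, 2, 2, 4, 4, 5, 4],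
    [0, 2, 4, 8, 11, 13]),
   ([1,1,1,0,1], [0, 0, 1, 2, 3, 0, 3, 2, 4, 4, 4, 5, 4, 4, 6, 6, 6, 7],
    [0, 2, 7, 4, 9, 11, 15, 17]),
   ([1,0,1,1,1], [0, 0, 1, 2, 2, 0, 2, 2, 3, 4, 5, 2, 5, 4, 6, 6, 6, 7],
    [0, 2, 4, 8, 9, 10, 14, 17]),
   ([1,1,0,0,1], [0, 0, 1, 2, 3, 0, 3, 2, 4, 4, 5, 4, 4, 6, 4, 6, 7, 6],
    [0, 2, 7, 4, 12, 10, 17, 16]),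
   ([1,0,1,0,1], [0, 0, 1, 2, 2, 0, 2, 2, 3, 4, 4, 2, 4, 4, 5, 6, 7, 4],
    [0, 2, 4, 8, 9, 14, 15, 16]),
   ([1,0,0,1,1], [0, 0, 1, 2, 2, 0, 2, 2, 3, 2, 2, 4, 4, 4, 5, 6, 7, 4],
    [0, 2, 4, 8, 11, 14, 15, 16]),
   ([1,0,0,0,1], [0, 0, 1, 2, 2, 0, 2, 2, 3, 2, 2, 4, 4, 5, 4, 6, 4, 7],
    [0, 2, 4, 8, 11, 13, 15, 17]),
   ([1,1,1,1,0], [0, 0, 1, 2, 3, 0, 3, 2, 4, 4, 4, 5, 6, 6, 4, 6, 6, 7],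
    [0, 2, 7, 4, 9, 11, 13, 17]),
   ([1,1,1,0,0], [0, 0, 1, 2, 3, 0, 3, 2, 4, 4, 4, 5, 4, 4, 6, 6, 7, 6],
    [0, 2, 7, 4, 9, 11, 15, 16]),
   ([1,0,1,1,0], [0, 0, 1, 2, 2, 0, 2, 2, 3, 4, 5, 2, 5, 4, 6, 6, 7, 6],
    [0, 2, 4, 8, 9, 10, 14, 16]),
   ([1,0,1,0,0], [0, 0, 1, 2, 2, 0, 2, 2, 3, 4, 5, 2, 4, 5, 4, 6, 6, 7],
    [0, 2, 4, 8, 9, 10, 15, 17]),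
   ([1,1,1,1,1,1], [0, 0, 1, 2, 3, 0, 3, 2, 4, 4, 4, 5, 6, 7, 4, 7, 6, 8, 8, 8, 9],
    [0, 2, 7, 4, 9, 11, 16, 13, 18, 20]),
   ([1,1,1,1,0,1], [0, 0, 1, 2, 3, 0, 3, 2, 4, 4, 4, 5, 6, 6, 4, 6, 6, 7, 8, 9, 6],
    [0, 2, 7, 4, 9, 11, 13, 17, 18, 19]),
   ([1,0,1,1,1,1], [0, 0, 1, 2, 2, 0, 2, 2, 3, 4, 5, 2, 5, 4, 6, 6, 6, 7, 8, 9, 6],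
    [0, 2, 4, 8, 9, 10, 14, 17, 18, 19]),
   ([1,0,1,1,0,1], [0, 0, 1, 2, 2, 0, 2, 2, 3, 4, 5, 2, 5, 4, 6, 6, 7, 6, 8, 6, 9],
    [0, 2, 4, 8, 9, 10, 14, 16, 18, 20]),
   ([1,0,1,0,0,1], [0, 0, 1, 2, 2, 0, 2, 2, 3, 4, 4, 2, 4, 4, 5, 4, 4, 6, 6, 6, 7],
    [0, 2, 4, 8, 9, 14, 17, 20]),
   ([1,0,0,1,0,1], [0, 0, 1, 2, 2, 0, 2, 2, 3, 2, 2, 4, 4, 4, 5, 4, 4, 6, 6, 6, 7],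
    [0, 2, 4, 8, 11, 14, 17, 20]),
   ([1,0,0,0,0,1], [0, 0, 1, 2, 2, 0, 2, 2, 3, 2, 2, 4, 4, 5, 4, 4, 6, 4, 6, 7, 6],
    [0, 2, 4, 8, 11, 13, 16, 19]),
   ([1,0,1,0,1,0], [0, 0, 1, 2, 2, 0, 2, 2, 3, 4, 4, 2, 4, 4, 5, 6, 6, 4, 6, 6, 7],
    [0, 2, 4, 8, 9, 14, 15, 20]),
   ([1,0,0,1,1,0], [0, 0, 1, 2, 2, 0, 2, 2, 3, 2, 2, 4, 4, 4, 5, 6, 6, 4, 6, 6, 7],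
    [0, 2, 4, 8, 11, 14, 15, 20]),
   ([1,0,1,0,0,0], [0, 0, 1, 2, 2, 0, 2, 2, 3, 4, 4, 2, 4, 4, 5, 4, 4, 6, 6, 7, 6],
    [0, 2, 4, 8, 9, 14, 17, 19]),
   ([1,0,0,1,0,0], [0, 0, 1, 2, 2, 0, 2, 2, 3, 2, 2, 4, 4, 4, 5, 4, 4, 6, 6, 7, 6],
    [0, 2, 4, 8, 11, 14, 17, 19]),
   ([1,0,0,0,1,0], [0, 0, 1, 2, 2, 0, 2, 2, 3, 2, 2, 4, 4, 5, 4, 6, 4, 6, 6, 7, 6],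
    [0, 2, 4, 8, 11, 13, 15, 19]),
   ([1,0,0,0,0,0], [0, 0, 1, 2, 2, 0, 2, 2, 3, 2, 2, 4, 4, 5, 4, 4, 6, 4, 6, 6, 7],
    [0, 2, 4, 8, 11, 13, 16, 20])
  ]

/-- The exhaustive part: the search is evaluated in the kernel and runs out of states for every code
marked n. -/
theorem hasFold_eq_false_of_table :
    ∀ e ∈ table, e.2 = false → hasFold (wordOf e.1) e.1.length = false := by
  have h : table.all (fun e => e.2 || !(hasFold (wordOf e.1) e.1.length)) = true := by
    decide +kernel
  intro e he h2
  have := List.all_eq_true.1 h e he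
  simpa [h2] using this

theorem exists_checkFold_of_table : ∀ e ∈ table, e.2 = true →
    ∃ m F G, 1 ≤ m ∧ checkFold (wordOf e.1) e.1.length m F G = true := by
  -- The last list of a certificate has two points for each of the `m + 1` antichains, whence the
  -- value of `m`.
  have h : table.all (fun e => !e.2 || foldCertificates.any fun c => c.1 == e.1 &&
      (Nat.ble 1 (c.2.2.length / 2 - 1) &&
        checkFold (wordOf e.1) e.1.length (c.2.2.length / 2 - 1) c.2.1 c.2.2)) = true := by
    decide +kernel
  intro e he h2
  have := List.all_eq_true.1 h e he
  rw [h2, Bool.not_true, Bool.false_or, List.any_eq_true] at this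
  obtain ⟨c, -, hc⟩ := this
  rw [Bool.and_eq_true, Bool.and_eq_true, Nat.ble_eq] at hc
  exact ⟨_, _, _, hc.2.1, hc.2.2⟩

/-- The first letter is fixed, so five free letters remain; truncation treats all lengths at once.
-/
theorem exists_mem_table (w : ℕ → Bool) (h0 : w 0 = true) (n : ℕ) (hn : 1 ≤ n) (hn' : n ≤ 6) :
    ∃ e ∈ table, e.1 = codeOf n w := by
  have key : ∀ b₁ b₂ b₃ b₄ b₅ : Bool, ∀ n < 7, 1 ≤ n → ∃ e ∈ table,
      e.1 = ([true, b₁, b₂, b₃, b₄, b₅].take n).map fun b => if b then 1 else 0 := by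
    decide +kernel
  obtain ⟨e, he, h⟩ := key (w 1) (w 2) (w 3) (w 4) (w 5) n (by omega) hn
  refine ⟨e, he, h.trans ?_⟩
  interval_cases n <;> simp [codeOf, List.range_succ, h0]

theorem table_head : ∀ e ∈ table, wordOf e.1 0 = true ∧ 1 ≤ e.1.length ∧ e.1.length ≤ 6 := by
  decide +kernel

/-- No code carries both marks, so `(c, true) ∈ table` determines the mark of `c`. -/
theorem table_unique : ∀ e ∈ table, ∀ e' ∈ table, e.1 = e'.1 → e = e' := by
  decide +kernel

theorem codeOf_wordOf (c : List (Fin 2)) : codeOf c.length (wordOf c) = c := by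
  refine List.ext_getElem (length_codeOf _ _) fun k _ hk => ?_
  have key : ∀ b : Fin 2, (if Nat.beq b 1 then 1 else 0) = b := by decide
  simp only [codeOf, List.getElem_map, List.getElem_range, wordOf,
    List.getD_eq_getElem _ _ hk, key]

/-- A member of `𝔑₂^LS` with code `c` is layered with the word of `c`. -/
theorem IsN2LS.exists_isLayering_wordOf {Q : Type u} [PartialOrder Q] (hQ : IsN2LS Q)
    {c : List (Fin 2)} (hc : HasCode Q c) :
    ∃ pos : Q → ℕ × Fin 3, IsLayering c.length (wordOf c) pos := by
  obtain ⟨w, pos, -, hpos⟩ := hQ.exists_isLayering hc.1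
  refine ⟨pos, hpos.congr_word fun k hk => ?_⟩
  have h1 := (hpos.hasCode_iff c).1 hc
  have h2 : wordOf c k = wordOf (codeOf c.length w) k := by rw [← h1]
  rw [h2, wordOf, codeOf, List.getD_eq_getElem _ _ (by simpa using hk), List.getElem_map,
    List.getElem_range]
  cases w k <;> rfl

theorem hasFourCrownStackRetract_iff_of_table {e : List (Fin 2) × Bool} (he : e ∈ table)
    {Q : Type u} [PartialOrder Q] (hQ : IsN2LS Q) (hc : HasCode Q e.1) :
    HasFourCrownStackRetract Q ↔ e.2 = true := by
  obtain ⟨pos, hpos⟩ := hQ.exists_isLayering_wordOf hc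
  constructor
  · intro h
    by_contra h2
    have := hpos.hasFold_eq_true h
    rw [hasFold_eq_false_of_table e he (Bool.eq_false_iff.2 h2)] at this
    cases this
  · intro h2
    obtain ⟨m, F, G, hm, hF⟩ := exists_checkFold_of_table e he h2
    exact hpos.hasFourCrownStackRetract hm hF

end NiceSection

theorem mainTheorem2 :
    -- every lower segment of height one to six has exactly one code, and the table lists it
    (∀ (Q : Type u) [PartialOrder Q], NiceSection.IsN2LS Q →
      ∀ n : ℕ, 1 ≤ n → n ≤ 6 → NiceSection.HasHeight Q n →
        ∃ e ∈ NiceSection.table, ∀ c : List (Fin 2), NiceSection.HasCode Q c ↔ c = e.1) ∧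
    -- every code listed in the table is the code of a lower segment, unique up to isomorphism
    (∀ e ∈ NiceSection.table,
      (∃ (Q : Type u) (_ : PartialOrder Q), NiceSection.IsN2LS Q ∧ NiceSection.HasCode Q e.1) ∧
      ∀ (Q Q' : Type u) [PartialOrder Q] [PartialOrder Q'],
        NiceSection.IsN2LS Q → NiceSection.IsN2LS Q' →
        NiceSection.HasCode Q e.1 → NiceSection.HasCode Q' e.1 → Nonempty (Q ≃o Q')) ∧
    -- the marks in the table are correct
    (∀ e ∈ NiceSection.table, ∀ (Q : Type u) [PartialOrder Q],
      NiceSection.IsN2LS Q → NiceSection.HasCode Q e.1 →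
        (NiceSection.HasFourCrownStackRetract Q ↔ e.2 = true)) ∧
    -- the resulting classification of the members of `𝔑₂` of height at most six
    (∀ (P : Type u) [PartialOrder P], NiceSection.IsN2 P →
      ∀ n : ℕ, n ≤ 6 → NiceSection.HasHeight P n →
        (NiceSection.HasFourCrownStackRetract P ↔
          ∃ c : List (Fin 2), NiceSection.HasCode P c ∧ (c, true) ∈ NiceSection.table)) := by
  open NiceSection in
  have codes : ∀ (Q : Type u) [PartialOrder Q], IsN2LS Q → ∀ n : ℕ, 1 ≤ n → n ≤ 6 →
      HasHeight Q n → ∃ e ∈ table, ∀ c : List (Fin 2), HasCode Q c ↔ c = e.1 := by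
    intro Q _ hQ n hn hn' hh
    obtain ⟨w, pos, h0, hpos⟩ := hQ.exists_isLayering hh
    obtain ⟨e, he, hec⟩ := exists_mem_table w h0 n hn hn'
    exact ⟨e, he, fun c => by rw [hec, hpos.hasCode_iff]⟩
  refine ⟨codes, fun e he => ⟨?_, fun Q Q' _ _ hQ hQ' hc hc' => ?_⟩, fun e he Q _ hQ hc =>
    NiceSection.hasFourCrownStackRetract_iff_of_table he hQ hc, fun P _ hP n hn hh => ?_⟩
  · obtain ⟨Q, _, pos, hQ, hpos⟩ := NiceSection.exists_isN2LS.{u} e.1.length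
      (NiceSection.wordOf e.1) (NiceSection.table_head e he).1
    exact ⟨Q, _, hQ, (hpos.hasCode_iff _).2 (NiceSection.codeOf_wordOf _).symm⟩
  · obtain ⟨pos, hpos⟩ := hQ.exists_isLayering_wordOf hc
    obtain ⟨pos', hpos'⟩ := hQ'.exists_isLayering_wordOf hc'
    exact hpos.nonempty_orderIso hpos'
  · have hLS := hP.isN2LS
    obtain ⟨-, h, h2, hh', -⟩ := id hP
    obtain rfl := hh.unique hh'
    obtain ⟨e, he, hec⟩ := codes P hLS n (by omega) hn hh
    rw [NiceSection.hasFourCrownStackRetract_iff_of_table he hLS ((hec _).2 rfl)]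
    constructor
    · intro h2
      exact ⟨e.1, (hec _).2 rfl, by rw [← h2]; exact he⟩
    · rintro ⟨c, hc, hct⟩
      have := NiceSection.table_unique e he _ hct ((hec c).1 hc).symm
      rw [this]
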